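/- A weighted graph is a set $V$ of vertices, finite or infinite, with a symmetric function $w:V\times V\to[0,\infty)$ such that $w_x:=\sum_{y} w(x,y)<\infty$ for every vertex $x$; its edges are the pairs with $w(x,y)>0$, and $w_z:=\sum_{x\in z}w_x$ for $z\subset V$. The random walk moves from $x$ to $y$ with probability $w(x,y)/w_x$. Let $o$ be a vertex with $w_o>0$ and let $z$ be a vertex set with graph distance $\mathrm{dist}(o,z)\ge n+1$ for some integer $n\ge 0$. Let $T_{oz}\in\{0,1,\dots\}\cup\{\infty\}$ be the first time at which the random walk started at $o$ is in $z$. Let $r_{oz}$ be the effective resistance between $o$ and $z$ in the electric network with conductances $w$, that is, the reciprocal of the infimum of $\frac12\sum_{x,y}w(x,y)(f(x)-f(y))^2$ over functions $f:V\to\mathbb R$ with $f(o)=1$ and $f=0$ on $z$; if $V$ is infinite, $r_{oz}$ may be either this free effective resistance or the wired one, in which only those $f$ are admitted that are constant outside a finite set. Let $g$ be either (a) a solution $g>1$ of $(g-1)^2g^{n-2}=2w_z/w_o$, or (b) $g=(w_z\,r_{oz})^{1/n}$, where $w_z r_{oz}<\infty$ (with $0\cdot\infty=0$; for $n=0$ read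 $g=1$, the value being immaterial). Let $T'_{0n}$ be the hitting time of $n$ for biased simple random walk on the integers started at $0$, which steps to the left with probability $1/(g+1)$ and to the right with probability $g/(g+1)$. Then for every $\lambda\ge 0$ $$\mathbf E\, e^{-\lambda (T'_{0n}+1)}\ \ge\ \mathbf E\, e^{-\lambda T_{oz}},$$ where $e^{-\lambda\cdot\infty}=0$ (also for $\lambda=0$). -/

import Mathlib

open MeasureTheory
open scoped ENNReal NNReal

noncomputable section

/-- A weighted graph on the vertex set `V` (finite or infinite): a symmetric nonnegative weight
function on pairs of vertices, loops allowed, with finite total weight at every vertex, so that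
the random walk is defined. -/
structure WeightedGraph (V : Type*) where
  weight : V → V → ℝ≥0
  symm : ∀ x y, weight x y = weight y x
  sum_ne_top : ∀ x, ∑' y, (weight x y : ℝ≥0∞) ≠ ⊤

namespace WeightedGraph

variable {V : Type*} (G : WeightedGraph V)

/-- The weight `w_x` of a vertex: the sum of the weights of the incident edges. -/
def vertexWeight (x : V) : ℝ≥0∞ := ∑' y, (G.weight x y : ℝ≥0∞)

/-- The weight `w_z` of a vertex set: the sum of the weights of its vertices. -/
def setWeight (z : Set V) : ℝ≥0∞ := ∑' x : z, G.vertexWeight x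

/-- The graph whose edges are the support of the weight function (loops do not affect the
graph distance and are left out). -/
def graph : SimpleGraph V where
  Adj x y := x ≠ y ∧ G.weight x y ≠ 0
  symm := ⟨fun x y h => ⟨h.1.symm, by rw [G.symm]; exact h.2⟩⟩
  loopless := ⟨fun _ h => h.1 rfl⟩

/-- Transition probabilities of the random walk: `w(x,y) / w_x`. -/
def transition (x y : V) : ℝ≥0∞ := (G.weight x y : ℝ≥0∞) / G.vertexWeight x

/-- The Dirichlet energy `½ ∑_{x,y} w(x,y) (f x - f y)²` of a potential. -/
def energy (f : V → ℝ) : ℝ≥0∞ :=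
  (∑' x, ∑' y, (G.weight x y : ℝ≥0∞) * ENNReal.ofReal ((f x - f y) ^ 2)) / 2

/-- The (free) effective resistance between `o` and `z` in the electric network whose
conductances are the edge weights: the reciprocal of the least energy of a potential that is `1`
at `o` and `0` on `z`. -/
def freeResistance (o : V) (z : Set V) : ℝ≥0∞ :=
  (⨅ f ∈ {f : V → ℝ | f o = 1 ∧ ∀ y ∈ z, f y = 0}, G.energy f)⁻¹

/-- The wired effective resistance between `o` and `z`: only potentials that are constant outside
a finite set compete. On a finite graph it is the same as the free one. -/
def wiredResistance (o : V) (z : Set V) : ℝ≥0∞ :=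
  (⨅ f ∈ {f : V → ℝ | f o = 1 ∧ (∀ y ∈ z, f y = 0) ∧ ∃ c, {x | f x ≠ c}.Finite}, G.energy f)⁻¹

end WeightedGraph

/-- Transition probabilities of biased simple random walk on the integers with odds `1` and `g`
of going left and right. -/
def biasedTransition (g : ℝ) (i j : ℤ) : ℝ≥0∞ :=
  if j = i + 1 then ENNReal.ofReal (g / (g + 1))
  else if j = i - 1 then ENNReal.ofReal (1 / (g + 1))
  else 0

/-- Under `P`, the process `X` is a Markov chain on `V` (a set with discrete σ-algebra) with
transition probabilities `K`, started at `o`. -/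
structure IsMarkovChain {V Ω : Type*} [MeasurableSpace Ω] (P : Measure Ω)
    (K : V → V → ℝ≥0∞) (o : V) (X : ℕ → Ω → V) : Prop where
  measurable : ∀ k, Measurable[_, ⊤] (X k)
  start : ∀ᵐ ω ∂P, X 0 ω = o
  step : ∀ (k : ℕ) (x : ℕ → V),
    P {ω | ∀ i ≤ k + 1, X i ω = x i} = P {ω | ∀ i ≤ k, X i ω = x i} * K (x k) (x (k + 1))

/-- The first time at which the process is in the set `A`, `⊤` if it never is. -/
def hittingTime {V Ω : Type*} (X : ℕ → Ω → V) (A : Set V) (ω : Ω) : ℕ∞ :=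
  ⨅ (k : ℕ) (_ : X k ω ∈ A), (k : ℕ∞)

/-- `e^{-l t}` for a possibly infinite time `t`, with `e^{-l ∞} = 0` (also for `l = 0`). -/
def expNeg (l : ℝ) (t : ℕ∞) : ℝ :=
  open Classical in if t = ⊤ then 0 else Real.exp (-l * (t.toNat : ℝ))

/-- The Laplace transform `E e^{-l T}` of a random time. -/
def laplace {Ω : Type*} [MeasurableSpace Ω] (P : Measure Ω) (T : Ω → ℕ∞) (l : ℝ) : ℝ :=
  ∫ ω, expNeg l (T ω) ∂P

end

/-!
Fix `s = e ^ (-λ) < 1`, kill the walk outside a finite set, and write `E s ^ T = s * m ^ n`, so that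
`m` is the discount that each of `n` equal stages would contribute after one extra step.

The derivative of `log E s ^ T` with respect to `log s` is the expected number of steps of the
discounted walk conditioned to hit `z`. The walk on `ℤ` with bias `g`, discounted so that each level
contributes a factor `m` and conditioned to hit `n`, has odds `q = g / m ^ 2` for a step to the
right and takes `(q + 1) / (q - 1)` steps per level. When the walk on the graph is as slow as that,
`s * (g / m + m)` is antitone in `s`; its limit at `1` is at least `g + 1`, and therefore
`(g + 1) * m ≤ s * (g + m ^ 2)`. This inequality says that `m ^ j`, with `j` the distance to `n`, is
subharmonic for the discounted biased walk, and hence that `m ^ n ≤ E s ^ T'`.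

The lower bound on the number of steps is a sum over edges. If the conditioned walk crosses an edge
`a` times in one direction and `b` times in the other, then
`a + b = coth (log (a / b) / 2) * |a - b|`, and the tangent line of the convex function
`D ↦ coth (D / 2)` at `D = log q` bounds this below by the flow `|a - b|` and the flow times the
potential drop `log (a / b)`. Each of the levels between `o` and `z` carries at least the unit flow.
By Jensen's inequality, the average potential drop is at most the logarithm of
`s ^ 2 * w_z * G / (E s ^ T) ^ 2`, where `G` is the Green function at `o`; this is at most
`n * log q` as soon as `w_z * G ≤ g ^ n`. In case (b) that holds because `G` is at most the
resistance. In case (a) the edges at `o` are counted separately, through the expected number of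
visits to `o`, which compensates for the size of `G`.
-/

noncomputable section

open Filter Topology

section Pace

variable {q g m a b : ℝ}

/-- The expected number of steps per unit of displacement, `coth (D / 2)` with `D = log q`, of the
biased walk on `ℤ` with odds `q`. It is meaningful for `1 < q`. -/
def pace (q : ℝ) : ℝ := (q + 1) / (q - 1)

/-- The slope `-d (pace q) / d (log q)` of the pace in the logarithm of the odds. -/
def paceSlope (q : ℝ) : ℝ := 2 * q / (q - 1) ^ 2

theorem pace_pos (hq : 1 < q) : 0 < pace q := div_pos (by linarith) (by linarith)

theorem paceSlope_pos (hq : 1 < q) : 0 < paceSlope q :=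
  div_pos (by linarith) (pow_pos (by linarith) 2)

theorem pace_add_paceSlope_mul_log_nonneg (hq : 1 < q) :
    0 ≤ pace q + paceSlope q * Real.log q :=
  add_nonneg (pace_pos hq).le (mul_nonneg (paceSlope_pos hq).le (Real.log_pos hq).le)

theorem pace_le_one_add_paceSlope (hq : 1 < q) : pace q ≤ 1 + paceSlope q := by
  have hq1 : q - 1 ≠ 0 := by linarith
  have hdiff : 1 + paceSlope q - pace q = 2 / (q - 1) ^ 2 := by
    rw [pace, paceSlope]
    field_simp
    ring
  have : 0 ≤ 2 / (q - 1) ^ 2 := by positivity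
  linarith

theorem pace_div_sq (hm : m ≠ 0) : pace (g / m ^ 2) = (g + m ^ 2) / (g - m ^ 2) := by
  rw [pace, div_add_one (pow_ne_zero 2 hm), div_sub_one (pow_ne_zero 2 hm),
    div_div_div_cancel_right₀ (pow_ne_zero 2 hm)]

/-- The tangent line of the convex function `D ↦ coth (D / 2)` at `D = log q`, evaluated at
`D = log (a / b)`, where `coth (D / 2) = (a + b) / (a - b)`. -/
theorem pace_tangent_le (hq : 1 < q) (ha : 0 < a) (hb : 0 < b) :
    (pace q + paceSlope q * Real.log q) * |a - b|
      - paceSlope q * ((a - b) * (Real.log a - Real.log b)) ≤ a + b := by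
  wlog hab : b ≤ a generalizing a b
  · have h := this hb ha (le_of_not_ge hab)
    rw [abs_sub_comm, add_comm a b]
    convert h using 2
    ring
  have hq1 : 0 < q - 1 := by linarith
  rw [abs_of_nonneg (sub_nonneg.2 hab)]
  have hlog : Real.log q - (Real.log a - Real.log b) ≤ q * b / a - 1 := by
    have h := Real.log_le_sub_one_of_pos (show 0 < q * b / a by positivity)
    rw [Real.log_div (by positivity) ha.ne', Real.log_mul (by positivity) hb.ne'] at h
    linarith
  have htangent := mul_le_mul_of_nonneg_left hlog
    (mul_nonneg (paceSlope_pos hq).le (sub_nonneg.2 hab))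
  have hdefect : a + b - pace q * (a - b) - paceSlope q * (a - b) * (q * b / a - 1)
      = 2 * (q * b - a) ^ 2 / ((q - 1) ^ 2 * a) := by
    rw [pace, paceSlope]
    field_simp
    ring
  have hnonneg : 0 ≤ 2 * (q * b - a) ^ 2 / ((q - 1) ^ 2 * a) := by positivity
  linarith

/-- The tangent plane of the convex function `(a, b) ↦ (a - b) * log (a / b)` along the ray
`a = q * b`. -/
theorem sub_mul_log_add_le (hq : 0 < q) (ha : 0 < a) (hb : 0 < b) :
    (a - b) * Real.log q + (1 - q⁻¹) * a + (1 - q) * b ≤ (a - b) * (Real.log a - Real.log b) := by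
  have h₁ := Real.log_le_sub_one_of_pos (show 0 < q * b / a by positivity)
  have h₂ := Real.log_le_sub_one_of_pos (show 0 < a / (q * b) by positivity)
  rw [Real.log_div (by positivity) ha.ne', Real.log_mul (by positivity) hb.ne'] at h₁
  rw [Real.log_div ha.ne' (by positivity), Real.log_mul (by positivity) hb.ne'] at h₂
  have ha' : a * (q * b / a - 1) = q * b - a := by field_simp
  have hb' : b * (a / (q * b) - 1) = q⁻¹ * a - b := by field_simp
  have := mul_le_mul_of_nonneg_left h₁ ha.le
  have := mul_le_mul_of_nonneg_left h₂ hb.le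
  linarith

theorem paceSlope_mul_sq_le_one (hg : 1 < g) (hgq : g ≤ q) :
    paceSlope q * (q * ((g - 1) ^ 2 / (2 * g ^ 2))) ≤ 1 := by
  have hg1 : 0 < g - 1 := by linarith
  have hq0 : 0 < q := by linarith
  have hq1 : 0 < q - 1 := by linarith
  have hsq : paceSlope q * (q * ((g - 1) ^ 2 / (2 * g ^ 2)))
      = (q * (g - 1) / ((q - 1) * g)) ^ 2 := by
    rw [paceSlope]
    field_simp
  rw [hsq]
  refine pow_le_one₀ (by positivity) ((div_le_one (by positivity)).2 ?_)
  linarith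

theorem nat_mul_pace_le {R : ℝ} (n : ℕ) (hg : 1 < g) (hgq : g ≤ q) (hR : 1 < R) :
    n * pace q ≤ (n - 1) * (pace q + paceSlope q * Real.log q)
      - paceSlope q *
        (Real.log (R * q ^ n * ((g - 1) ^ 2 / (2 * g ^ 2))) - Real.log (R / (R - 1))) + R := by
  have hq0 : 0 < q := by linarith
  have hR0 : 0 < R := by linarith
  have hR1 : 0 < R - 1 := by linarith
  have hβ := paceSlope_pos (hg.trans_le hgq)
  have hYq := paceSlope_mul_sq_le_one hg hgq
  set Y := (g - 1) ^ 2 / (2 * g ^ 2)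
  have hY : 0 < Y := div_pos (pow_pos (by linarith) 2) (by positivity)
  have hlogs : Real.log (R * q ^ n * Y) - Real.log (R / (R - 1)) =
      (n - 1) * Real.log q + Real.log (q * Y * (R - 1)) := by
    rw [Real.log_mul (by positivity) hY.ne', Real.log_mul hR0.ne' (by positivity), Real.log_pow,
      Real.log_div hR0.ne' hR1.ne', Real.log_mul (by positivity) hR1.ne',
      Real.log_mul hq0.ne' hY.ne']
    ring
  have hlog : Real.log (q * Y * (R - 1)) ≤ (R - 1) / paceSlope q - 1 := by
    refine (Real.log_le_log (by positivity) ?_).trans (Real.log_le_sub_one_of_pos (div_pos hR1 hβ))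
    rw [le_div_iff₀ hβ]
    linarith [mul_le_mul_of_nonneg_right hYq hR1.le]
  have hmul : paceSlope q * Real.log (q * Y * (R - 1)) ≤ R - 1 - paceSlope q := by
    refine (mul_le_mul_of_nonneg_left hlog hβ.le).trans_eq ?_
    field_simp
  rw [hlogs]
  linarith [pace_le_one_add_paceSlope (hg.trans_le hgq)]

end Pace

section Decay

variable {g s t ρ : ℝ} {m : ℝ → ℝ}

theorem deriv_mul_div_add_nonpos (ht : 0 < t) (hm : 0 < m t) (hg : m t ^ 2 < g)
    (hderiv : HasDerivAt m (m t * ρ / t) t) (hρ : pace (g / m t ^ 2) ≤ ρ) :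
    ∃ H', HasDerivAt (fun t => t * (g / m t + m t)) H' t ∧ H' ≤ 0 := by
  refine ⟨_, (hasDerivAt_id t).mul (((hasDerivAt_const t g).div hderiv hm.ne').add hderiv), ?_⟩
  rw [pace_div_sq hm.ne', div_le_iff₀ (sub_pos.2 hg)] at hρ
  have hH' : 1 * (g / m t + m t) + t * ((0 * m t - g * (m t * ρ / t)) / m t ^ 2 + m t * ρ / t)
      = (g + m t ^ 2 - ρ * (g - m t ^ 2)) / m t := by
    field_simp
    ring
  exact hH'.trans_le (div_nonpos_of_nonpos_of_nonneg (by linarith) hm.le)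

theorem add_one_mul_le_of_hasDerivAt {ρ : ℝ → ℝ} (hs : s ∈ Set.Ioo (0 : ℝ) 1)
    (hm : ∀ t ∈ Set.Ico s 1, m t ∈ Set.Ioo (0 : ℝ) 1) (hmg : ∀ t ∈ Set.Ico s 1, m t ≤ g)
    (hderiv : ∀ t ∈ Set.Ico s 1, HasDerivAt m (m t * ρ t / t) t)
    (hρ : ∀ t ∈ Set.Ico s 1, pace (g / m t ^ 2) ≤ ρ t) :
    (g + 1) * m s ≤ s * (g + m s ^ 2) := by
  have hdecr : ∀ t ∈ Set.Ico s 1,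
      ∃ H', HasDerivAt (fun t => t * (g / m t + m t)) H' t ∧ H' ≤ 0 := fun t ht =>
    deriv_mul_div_add_nonpos (hs.1.trans_le ht.1) (hm t ht).1
      (by nlinarith [(hm t ht).1, (hm t ht).2, hmg t ht]) (hderiv t ht) (hρ t ht)
  choose! H' hH' hH'0 using hdecr
  have hanti : AntitoneOn (fun t => t * (g / m t + m t)) (Set.Ico s 1) :=
    antitoneOn_of_hasDerivWithinAt_nonpos (convex_Ico s 1)
      (fun t ht => (hH' t ht).continuousAt.continuousWithinAt)
      (fun t ht => (hH' t (interior_subset ht)).hasDerivWithinAt)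
      (fun t ht => hH'0 t (interior_subset ht))
  have hlower : ∀ t ∈ Set.Ico s 1, t * (g + 1) ≤ t * (g / m t + m t) := fun t ht => by
    have hmt := hm t ht
    refine mul_le_mul_of_nonneg_left ?_ (hs.1.le.trans ht.1)
    rw [div_add' _ _ _ hmt.1.ne', le_div_iff₀ hmt.1]
    nlinarith [mul_nonneg (sub_nonneg.2 hmt.2.le) (sub_nonneg.2 (hmg t ht))]
  have hlim : Tendsto (fun t : ℝ => t * (g + 1)) (𝓝[<] 1) (𝓝 (g + 1)) := by
    simpa using ((tendsto_id (x := 𝓝 (1 : ℝ))).mul_const (g + 1)).mono_left nhdsWithin_le_nhds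
  have hH : g + 1 ≤ s * (g / m s + m s) := by
    refine le_of_tendsto hlim ?_
    filter_upwards [Ico_mem_nhdsLT hs.2] with t ht
    exact (hlower t ht).trans (hanti ⟨le_rfl, hs.2⟩ ht ht.1)
  have hms := (hm s ⟨le_rfl, hs.2⟩).1
  calc (g + 1) * m s ≤ s * (g / m s + m s) * m s := mul_le_mul_of_nonneg_right hH hms.le
    _ = s * (g + m s ^ 2) := by field_simp

end Decay

section DoubleSums

variable {ι : Type*} [Fintype ι] {θ : ι → ι → ℝ}

theorem sum_mul_sub_of_antisymm (h : ∀ x y, θ y x = -θ x y) (f : ι → ℝ) :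
    ∑ x, ∑ y, θ x y * (f x - f y) = 2 * ∑ x, f x * ∑ y, θ x y := by
  have hswap : ∑ x, ∑ y, θ x y * f y = -∑ x, ∑ y, θ x y * f x := by
    rw [Finset.sum_comm]
    simp only [← Finset.sum_neg_distrib, ← neg_mul, ← h]
  simp only [mul_sub, Finset.sum_sub_distrib, hswap, sub_neg_eq_add, ← two_mul, ← Finset.sum_mul,
    mul_comm]

theorem sum_sum_eq_sum_erase_add [DecidableEq ι] (h : ∀ x y, θ y x = θ x y) (o : ι) :
    ∑ x, ∑ y, θ x y = ∑ x ∈ Finset.univ.erase o, ∑ y ∈ Finset.univ.erase o, θ x y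
      + (2 * ∑ y, θ o y - θ o o) := by
  have hrow : ∀ x, ∑ y, θ x y = θ o x + ∑ y ∈ Finset.univ.erase o, θ x y := fun x => by
    rw [← h o x, Finset.add_sum_erase _ _ (Finset.mem_univ o)]
  rw [← Finset.add_sum_erase _ _ (Finset.mem_univ o), Finset.sum_congr rfl fun x _ => hrow x,
    Finset.sum_add_distrib, hrow o]
  ring

end DoubleSums

/-- A finite network with symmetric conductances `c` between interior vertices, conductance `b`
from each interior vertex to the target, and vertex weights `W` that dominate the total
conductance. The walk moves with probabilities `c / W` and `b / W`; the excess of `W` is the rate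
of killing. -/
structure KilledNetwork (ι : Type*) [Fintype ι] where
  c : ι → ι → ℝ
  c_nonneg : ∀ x y, 0 ≤ c x y
  c_symm : ∀ x y, c x y = c y x
  W : ι → ℝ
  W_pos : ∀ x, 0 < W x
  b : ι → ℝ
  b_nonneg : ∀ x, 0 ≤ b x
  sum_le : ∀ x, ∑ y, c x y + b x ≤ W x

namespace KilledNetwork

section PotentialTheory

variable {ι : Type*} [Fintype ι] (N : KilledNetwork ι) {s t : ℝ} {o x y : ι} {f : ι → ℝ}

/-- The Laplacian of the network in which the walk in addition survives every step only with
probability `s`. -/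
def laplacian (s : ℝ) : (ι → ℝ) →ₗ[ℝ] (ι → ℝ) :=
  LinearMap.pi fun x => N.W x • LinearMap.proj x - s • ∑ y, N.c x y • LinearMap.proj y

theorem laplacian_apply (s : ℝ) (f : ι → ℝ) (x : ι) :
    N.laplacian s f x = N.W x * f x - s * ∑ y, N.c x y * f y := by
  simp [laplacian]

theorem sum_c_le (x : ι) : ∑ y, N.c x y ≤ N.W x := by
  linarith [N.sum_le x, N.b_nonneg x]

theorem sum_c_mul_nonneg (hf : 0 ≤ f) (x : ι) : 0 ≤ ∑ y, N.c x y * f y :=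
  Finset.sum_nonneg fun y _ => mul_nonneg (N.c_nonneg x y) (hf y)

theorem nonneg_of_laplacian_nonneg_of_le (hs : s ∈ Set.Ico (0 : ℝ) 1)
    (hx : 0 ≤ N.laplacian s f x) (hmin : ∀ y, f x ≤ f y) : 0 ≤ f x := by
  by_contra! hneg
  have hsum : (∑ y, N.c x y) * f x ≤ ∑ y, N.c x y * f y := by
    rw [Finset.sum_mul]
    exact Finset.sum_le_sum fun y _ => mul_le_mul_of_nonneg_left (hmin y) (N.c_nonneg x y)
  have hW : N.W x * f x ≤ (∑ y, N.c x y) * f x :=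
    mul_le_mul_of_nonpos_right (N.sum_c_le x) hneg.le
  have hs' : s * (N.W x * f x) ≤ s * ∑ y, N.c x y * f y :=
    mul_le_mul_of_nonneg_left (hW.trans hsum) hs.1
  have hWneg : N.W x * f x < 0 := mul_neg_of_pos_of_neg (N.W_pos x) hneg
  rw [laplacian_apply] at hx
  nlinarith [hs.2]

theorem nonneg_of_laplacian_nonneg (hs : s ∈ Set.Ico (0 : ℝ) 1) (h : 0 ≤ N.laplacian s f) :
    0 ≤ f := by
  intro x
  obtain ⟨x₀, -, hx₀⟩ := Finset.exists_min_image Finset.univ f ⟨x, Finset.mem_univ x⟩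
  have hmin : ∀ y, f x₀ ≤ f y := fun y => hx₀ y (Finset.mem_univ y)
  exact (N.nonneg_of_laplacian_nonneg_of_le hs (h x₀) hmin).trans (hmin x)

theorem laplacian_surjective (hs : s ∈ Set.Ico (0 : ℝ) 1) :
    Function.Surjective (N.laplacian s) := by
  refine LinearMap.injective_iff_surjective.mp ?_
  rw [← LinearMap.ker_eq_bot, LinearMap.ker_eq_bot']
  intro f hf
  have hneg : 0 ≤ -f := N.nonneg_of_laplacian_nonneg hs (by rw [map_neg, hf, neg_zero])
  exact le_antisymm (neg_nonneg.mp hneg) (N.nonneg_of_laplacian_nonneg hs hf.ge)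

theorem sum_mul_laplacian_comm (s : ℝ) (f g : ι → ℝ) :
    ∑ x, f x * N.laplacian s g x = ∑ x, g x * N.laplacian s f x := by
  have hswap : ∑ x, ∑ y, s * (f x * (N.c x y * g y)) = ∑ x, ∑ y, s * (g x * (N.c x y * f y)) := by
    rw [Finset.sum_comm]
    refine Finset.sum_congr rfl fun x _ => Finset.sum_congr rfl fun y _ => ?_
    rw [N.c_symm y x]
    ring
  simp only [laplacian_apply, mul_sub, Finset.sum_sub_distrib, Finset.mul_sum, mul_left_comm _ s]
  rw [hswap]
  congr 1
  exact Finset.sum_congr rfl fun x _ => by ring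

theorem pos_of_adj (hs : s ∈ Set.Ioo (0 : ℝ) 1) (hf : 0 ≤ N.laplacian s f) (hx : 0 < f x)
    (hxy : N.c x y ≠ 0) : 0 < f y := by
  have hf0 := N.nonneg_of_laplacian_nonneg ⟨hs.1.le, hs.2⟩ hf
  have hc : 0 < N.c y x := (N.c_nonneg y x).lt_of_ne' (N.c_symm x y ▸ hxy)
  have hle : N.c y x * f x ≤ ∑ z, N.c y z * f z :=
    Finset.single_le_sum (f := fun z => N.c y z * f z)
      (fun z _ => mul_nonneg (N.c_nonneg y z) (hf0 z)) (Finset.mem_univ x)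
  have hsum : 0 < s * ∑ z, N.c y z * f z := mul_pos hs.1 ((mul_pos hc hx).trans_le hle)
  have hy : 0 ≤ N.laplacian s f y := hf y
  rw [laplacian_apply] at hy
  exact pos_of_mul_pos_right (by linarith : 0 < N.W y * f y) (N.W_pos y).le

theorem pos_of_laplacian_pos (hs : s ∈ Set.Ico (0 : ℝ) 1) (hf : 0 ≤ N.laplacian s f)
    (hx : 0 < N.laplacian s f x) : 0 < f x := by
  have hsum := mul_nonneg hs.1 (N.sum_c_mul_nonneg (N.nonneg_of_laplacian_nonneg hs hf) x)
  rw [laplacian_apply] at hx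
  exact pos_of_mul_pos_right (by linarith : 0 < N.W x * f x) (N.W_pos x).le

/-- The discounted hitting function `x ↦ E_x s^T` of the target. It is given by the Dirichlet
problem and is meaningful for `0 ≤ s < 1`. -/
def hit (s : ℝ) : ι → ℝ := Function.invFun (N.laplacian s) (s • N.b)

/-- The discounted Green function with pole `o`: the expected discounted number of visits to `o`
from `x`, divided by `W o`. It is meaningful for `0 ≤ s < 1`. -/
def green (s : ℝ) (o : ι) : ι → ℝ :=
  open Classical in Function.invFun (N.laplacian s) (Pi.single o 1)

theorem laplacian_hit (hs : s ∈ Set.Ico (0 : ℝ) 1) : N.laplacian s (N.hit s) = s • N.b :=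
  Function.invFun_eq (N.laplacian_surjective hs _)

theorem laplacian_green (hs : s ∈ Set.Ico (0 : ℝ) 1) (o : ι) [DecidableEq ι] :
    N.laplacian s (N.green s o) = Pi.single o 1 := by
  unfold green
  convert Function.invFun_eq (N.laplacian_surjective hs (Pi.single o 1))

theorem laplacian_hit_nonneg (hs : s ∈ Set.Ico (0 : ℝ) 1) : 0 ≤ N.laplacian s (N.hit s) := by
  rw [N.laplacian_hit hs]
  exact smul_nonneg hs.1 N.b_nonneg

theorem laplacian_green_nonneg (hs : s ∈ Set.Ico (0 : ℝ) 1) (o : ι) :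
    0 ≤ N.laplacian s (N.green s o) := by
  classical
  rw [N.laplacian_green hs]
  exact Pi.single_nonneg.2 zero_le_one

theorem hit_nonneg (hs : s ∈ Set.Ico (0 : ℝ) 1) (x : ι) : 0 ≤ N.hit s x :=
  N.nonneg_of_laplacian_nonneg hs (N.laplacian_hit_nonneg hs) x

theorem green_nonneg (hs : s ∈ Set.Ico (0 : ℝ) 1) (o x : ι) : 0 ≤ N.green s o x :=
  N.nonneg_of_laplacian_nonneg hs (N.laplacian_green_nonneg hs o) x

theorem W_mul_hit (hs : s ∈ Set.Ico (0 : ℝ) 1) (x : ι) :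
    N.W x * N.hit s x = s * ∑ y, N.c x y * N.hit s y + s * N.b x := by
  have h := congrFun (N.laplacian_hit hs) x
  rw [laplacian_apply, Pi.smul_apply, smul_eq_mul] at h
  linarith

theorem W_mul_green_self (hs : s ∈ Set.Ico (0 : ℝ) 1) (o : ι) :
    N.W o * N.green s o o = s * ∑ y, N.c o y * N.green s o y + 1 := by
  classical
  have h := congrFun (N.laplacian_green hs o) o
  rw [laplacian_apply, Pi.single_eq_same] at h
  linarith

theorem W_mul_green_of_ne (hs : s ∈ Set.Ico (0 : ℝ) 1) (hx : x ≠ o) :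
    N.W x * N.green s o x = s * ∑ y, N.c x y * N.green s o y := by
  classical
  have h := congrFun (N.laplacian_green hs o) x
  rw [laplacian_apply, Pi.single_eq_of_ne hx] at h
  linarith

theorem hit_le (hs : s ∈ Set.Ico (0 : ℝ) 1) (x : ι) : N.hit s x ≤ s := by
  refine sub_nonneg.1 <|
    N.nonneg_of_laplacian_nonneg (f := fun y => s - N.hit s y) hs (fun y => ?_) x
  have h := N.W_mul_hit hs y
  have hc : 0 ≤ ∑ x, N.c y x := Finset.sum_nonneg fun x _ => N.c_nonneg y x
  simp only [Pi.zero_apply, laplacian_apply, mul_sub, Finset.sum_sub_distrib, ← Finset.sum_mul]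
  nlinarith [mul_nonneg hs.1 (sub_nonneg.2 (N.sum_le y)),
    mul_nonneg (mul_nonneg hs.1 hc) (sub_nonneg.2 hs.2.le)]

theorem hit_le_sq (hs : s ∈ Set.Ico (0 : ℝ) 1) (hb : N.b x = 0) : N.hit s x ≤ s ^ 2 := by
  have hsum : ∑ y, N.c x y * N.hit s y ≤ s * N.W x := by
    calc ∑ y, N.c x y * N.hit s y ≤ ∑ y, N.c x y * s :=
          Finset.sum_le_sum fun y _ => mul_le_mul_of_nonneg_left (N.hit_le hs y) (N.c_nonneg x y)
      _ = s * ∑ y, N.c x y := by rw [← Finset.sum_mul, mul_comm]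
      _ ≤ s * N.W x := mul_le_mul_of_nonneg_left (N.sum_c_le x) hs.1
  have hW := N.W_mul_hit hs x
  rw [hb, mul_zero, add_zero] at hW
  nlinarith [N.W_pos x, mul_le_mul_of_nonneg_left hsum hs.1]

theorem green_pole_pos (hs : s ∈ Set.Ico (0 : ℝ) 1) (o : ι) : 0 < N.green s o o := by
  classical
  refine N.pos_of_laplacian_pos hs (N.laplacian_green_nonneg hs o) ?_
  rw [N.laplacian_green hs, Pi.single_eq_same]
  exact one_pos

theorem green_le_pole (hs : s ∈ Set.Ico (0 : ℝ) 1) (o x : ι) : N.green s o x ≤ N.green s o o := by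
  obtain ⟨x₀, -, hx₀⟩ :=
    Finset.exists_min_image Finset.univ (fun y => -N.green s o y) ⟨x, Finset.mem_univ x⟩
  have hmin : ∀ y, (-N.green s o) x₀ ≤ (-N.green s o) y := fun y => hx₀ y (Finset.mem_univ y)
  refine (neg_le_neg_iff.1 (hmin x)).trans ?_
  rcases eq_or_ne x₀ o with rfl | h
  · exact le_rfl
  have hlap : 0 ≤ N.laplacian s (-N.green s o) x₀ := by
    classical
    rw [map_neg, N.laplacian_green hs, Pi.neg_apply, Pi.single_eq_of_ne h, neg_zero]
  have hneg := N.nonneg_of_laplacian_nonneg_of_le hs hlap hmin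
  exact (neg_nonneg.1 hneg).trans (N.green_pole_pos hs o).le

theorem hit_pos (hs : s ∈ Set.Ioo (0 : ℝ) 1) (hx : N.b x ≠ 0) : 0 < N.hit s x := by
  have hs' := Set.Ioo_subset_Ico_self hs
  refine N.pos_of_laplacian_pos hs' (N.laplacian_hit_nonneg hs') ?_
  rw [N.laplacian_hit hs']
  exact mul_pos hs.1 ((N.b_nonneg x).lt_of_ne' hx)

theorem sum_green_mul_laplacian (hs : s ∈ Set.Ico (0 : ℝ) 1) (o : ι) (f : ι → ℝ) :
    ∑ x, N.green s o x * N.laplacian s f x = f o := by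
  classical
  rw [sum_mul_laplacian_comm, N.laplacian_green hs]
  simp [Pi.single_apply]

theorem hit_sub_hit (hs : s ∈ Set.Ico (0 : ℝ) 1) (ht : t ∈ Set.Ioo (0 : ℝ) 1) (o : ι) :
    N.hit t o - N.hit s o = (1 - s / t) * ∑ x, N.W x * N.green s o x * N.hit t x := by
  rw [← Pi.sub_apply, ← N.sum_green_mul_laplacian hs o (N.hit t - N.hit s), Finset.mul_sum]
  refine Finset.sum_congr rfl fun x _ => ?_
  have ht0 := ht.1.ne'
  have hWt : ∑ y, N.c x y * N.hit t y = N.W x * N.hit t x / t - N.b x := by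
    rw [N.W_mul_hit (Set.Ioo_subset_Ico_self ht)]
    field_simp
    ring
  rw [map_sub, N.laplacian_hit hs, Pi.sub_apply, laplacian_apply, hWt, Pi.smul_apply, smul_eq_mul]
  field_simp
  ring

theorem sum_W_mul_green_mul_nonneg (hs : s ∈ Set.Ico (0 : ℝ) 1) (hf : 0 ≤ f) (o : ι) :
    0 ≤ ∑ x, N.W x * N.green s o x * f x :=
  Finset.sum_nonneg fun x _ =>
    mul_nonneg (mul_nonneg (N.W_pos x).le (N.green_nonneg hs o x)) (hf x)

theorem hit_mono (hs : s ∈ Set.Ioo (0 : ℝ) 1) (ht : t ∈ Set.Ioo (0 : ℝ) 1) (hst : s ≤ t) :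
    N.hit s ≤ N.hit t := by
  intro x
  have hs' := Set.Ioo_subset_Ico_self hs
  rw [← sub_nonneg, N.hit_sub_hit hs' ht]
  exact mul_nonneg (sub_nonneg.2 ((div_le_one ht.1).2 hst))
    (N.sum_W_mul_green_mul_nonneg hs' (N.hit_nonneg (Set.Ioo_subset_Ico_self ht)) x)

theorem tendsto_hit (hs : s ∈ Set.Ioo (0 : ℝ) 1) (x : ι) :
    Tendsto (fun t => N.hit t x) (𝓝 s) (𝓝 (N.hit s x)) := by
  have hs' := Set.Ioo_subset_Ico_self hs
  have hlim : Tendsto (fun t => |1 - s / t| * ∑ y, N.W y * N.green s x y) (𝓝 s) (𝓝 0) := by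
    have hcont : ContinuousAt (fun t => |1 - s / t| * ∑ y, N.W y * N.green s x y) s := by
      fun_prop (disch := exact hs.1.ne')
    simpa [hs.1.ne'] using hcont.tendsto
  rw [tendsto_iff_dist_tendsto_zero]
  refine squeeze_zero' (Eventually.of_forall fun _ => dist_nonneg) ?_ hlim
  filter_upwards [isOpen_Ioo.mem_nhds hs] with t ht
  have ht' := Set.Ioo_subset_Ico_self ht
  rw [Real.dist_eq, N.hit_sub_hit hs' ht, abs_mul,
    abs_of_nonneg (N.sum_W_mul_green_mul_nonneg hs' (N.hit_nonneg ht') x)]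
  exact mul_le_mul_of_nonneg_left (Finset.sum_le_sum fun y _ => mul_le_of_le_one_right
    (mul_nonneg (N.W_pos y).le (N.green_nonneg hs' x y)) ((N.hit_le ht' y).trans ht.2.le))
    (abs_nonneg _)

theorem hasDerivAt_hit (hs : s ∈ Set.Ioo (0 : ℝ) 1) (o : ι) :
    HasDerivAt (fun t => N.hit t o) ((∑ x, N.W x * N.green s o x * N.hit s x) / s) s := by
  rw [hasDerivAt_iff_tendsto_slope]
  have hlim : Tendsto (fun t => (∑ x, N.W x * N.green s o x * N.hit t x) / t) (𝓝[≠] s)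
      (𝓝 ((∑ x, N.W x * N.green s o x * N.hit s x) / s)) :=
    ((tendsto_finsetSum _ fun x _ => (N.tendsto_hit hs x).const_mul _).div tendsto_id
      hs.1.ne').mono_left nhdsWithin_le_nhds
  refine hlim.congr' ?_
  filter_upwards [self_mem_nhdsWithin, mem_nhdsWithin_of_mem_nhds (isOpen_Ioo.mem_nhds hs)]
    with t hts ht
  have hts' : t - s ≠ 0 := sub_ne_zero.2 hts
  have ht0 := ht.1.ne'
  rw [slope_def_field, N.hit_sub_hit (Set.Ioo_subset_Ico_self hs) ht]
  field_simp

end PotentialTheory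

variable {ι : Type*} [Fintype ι] (N : KilledNetwork ι) {s q κ g : ℝ} {o x y : ι} {n : ℕ}

section ConditionedWalk

/-- The expected discounted number of steps from `x` to `y` that the walk started at `o` makes
on the event that it hits the target. -/
def crossings (s : ℝ) (o x y : ι) : ℝ := s * N.c x y * (N.green s o x * N.hit s y)

/-- The net flow from the pole `o` to the target carried by the walk that hits the target. -/
def flow (s : ℝ) (o x y : ι) : ℝ := N.crossings s o x y - N.crossings s o y x

/-- The probability, discounted by `s ^ T`, that the walk started at `o` hits the target at time
`T`, coming from `x`. -/
def exitMass (s : ℝ) (o x : ι) : ℝ := s * N.green s o x * N.b x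

/-- The potential whose drop along an edge is the logarithm of the ratio of the numbers of
crossings of the edge in its two directions. -/
def potential (s : ℝ) (o x : ι) : ℝ := Real.log (N.green s o x) - Real.log (N.hit s x)

/-- The expected discounted number of visits to `o` of the walk started at `o`. -/
def visits (s : ℝ) (o : ι) : ℝ := N.W o * N.green s o o

theorem flow_antisymm (s : ℝ) (o x y : ι) : N.flow s o y x = -N.flow s o x y := by
  rw [flow, flow, neg_sub]

theorem crossings_nonneg (hs : s ∈ Set.Ico (0 : ℝ) 1) (o x y : ι) : 0 ≤ N.crossings s o x y :=
  mul_nonneg (mul_nonneg hs.1 (N.c_nonneg x y))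
    (mul_nonneg (N.green_nonneg hs o x) (N.hit_nonneg hs y))

theorem exitMass_nonneg (hs : s ∈ Set.Ico (0 : ℝ) 1) (o x : ι) : 0 ≤ N.exitMass s o x :=
  mul_nonneg (mul_nonneg hs.1 (N.green_nonneg hs o x)) (N.b_nonneg x)

theorem sum_exitMass (hs : s ∈ Set.Ico (0 : ℝ) 1) (o : ι) :
    ∑ x, N.exitMass s o x = N.hit s o := by
  rw [← N.sum_green_mul_laplacian hs o (N.hit s), N.laplacian_hit hs]
  simp only [exitMass, Pi.smul_apply, smul_eq_mul]
  exact Finset.sum_congr rfl fun x _ => by ring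

theorem sum_crossings_left (hs : s ∈ Set.Ico (0 : ℝ) 1) (o x : ι) :
    ∑ y, N.crossings s o x y = N.W x * N.green s o x * N.hit s x - N.exitMass s o x := by
  have hsum : ∑ y, N.crossings s o x y = N.green s o x * (s * ∑ y, N.c x y * N.hit s y) := by
    simp only [crossings, Finset.mul_sum]
    exact Finset.sum_congr rfl fun y _ => by ring
  rw [hsum, exitMass]
  linear_combination -N.green s o x * N.W_mul_hit hs x

theorem sum_crossings_right (s : ℝ) (o x : ι) :
    ∑ y, N.crossings s o y x = N.hit s x * (s * ∑ y, N.c x y * N.green s o y) := by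
  simp only [crossings, Finset.mul_sum, N.c_symm x]
  exact Finset.sum_congr rfl fun y _ => by ring

theorem sum_sum_crossings (hs : s ∈ Set.Ico (0 : ℝ) 1) (o : ι) :
    ∑ x, ∑ y, N.crossings s o x y = ∑ x, N.W x * N.green s o x * N.hit s x - N.hit s o := by
  simp only [N.sum_crossings_left hs, Finset.sum_sub_distrib, N.sum_exitMass hs]

theorem sum_crossings_from_pole (hs : s ∈ Set.Ico (0 : ℝ) 1) (hb : N.b o = 0) :
    ∑ y, N.crossings s o o y = N.hit s o * N.visits s o := by
  rw [N.sum_crossings_left hs, exitMass, hb, visits]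
  ring

theorem sum_crossings_to_pole (hs : s ∈ Set.Ico (0 : ℝ) 1) (o : ι) :
    ∑ y, N.crossings s o y o = N.hit s o * (N.visits s o - 1) := by
  rw [sum_crossings_right, visits, N.W_mul_green_self hs]
  ring

theorem sum_flow_pole (hs : s ∈ Set.Ico (0 : ℝ) 1) (o : ι) :
    ∑ y, N.flow s o o y = N.hit s o - N.exitMass s o o := by
  simp only [flow, Finset.sum_sub_distrib, N.sum_crossings_left hs, N.sum_crossings_to_pole hs,
    visits]
  ring

theorem sum_flow_of_ne (hs : s ∈ Set.Ico (0 : ℝ) 1) (hx : x ≠ o) :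
    ∑ y, N.flow s o x y = -N.exitMass s o x := by
  simp only [flow, Finset.sum_sub_distrib, N.sum_crossings_left hs, sum_crossings_right,
    ← N.W_mul_green_of_ne hs hx]
  ring

theorem sum_flow_mul_sub (hs : s ∈ Set.Ico (0 : ℝ) 1) (o : ι) (f : ι → ℝ) :
    ∑ x, ∑ y, N.flow s o x y * (f x - f y) = 2 * ∑ x, N.exitMass s o x * (f o - f x) := by
  classical
  have hflow : ∀ x, ∑ y, N.flow s o x y = (if x = o then N.hit s o else 0) - N.exitMass s o x :=
    fun x => by
      split_ifs with hx
      · rw [hx, N.sum_flow_pole hs]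
      · rw [N.sum_flow_of_ne hs hx, zero_sub]
  rw [sum_mul_sub_of_antisymm (N.flow_antisymm s o)]
  simp only [hflow, mul_comm (f _), sub_mul, mul_sub, ite_mul, zero_mul, Finset.sum_sub_distrib,
    Finset.sum_ite_eq', Finset.mem_univ, if_true, ← Finset.sum_mul, N.sum_exitMass hs]

theorem crossings_eq_zero_or_pos (hs : s ∈ Set.Ioo (0 : ℝ) 1) (o x y : ι) :
    (N.crossings s o x y = 0 ∧ N.crossings s o y x = 0) ∨
    (0 < N.crossings s o x y ∧ 0 < N.crossings s o y x ∧
      N.potential s o x - N.potential s o y =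
        Real.log (N.crossings s o x y) - Real.log (N.crossings s o y x)) := by
  have hs' := Set.Ioo_subset_Ico_self hs
  have hG : ∀ {x y}, 0 < N.green s o x → N.c x y ≠ 0 → 0 < N.green s o y :=
    N.pos_of_adj hs (N.laplacian_green_nonneg hs' o)
  have hH : ∀ {x y}, 0 < N.hit s x → N.c x y ≠ 0 → 0 < N.hit s y :=
    N.pos_of_adj hs (N.laplacian_hit_nonneg hs')
  simp only [crossings, N.c_symm y x]
  by_cases hc : N.c x y = 0
  · simp [hc]
  have hc' : N.c y x ≠ 0 := N.c_symm x y ▸ hc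
  rcases (N.green_nonneg hs' o x).eq_or_lt with hgx | hgx
  · have hgy : N.green s o y = 0 :=
      ((N.green_nonneg hs' o y).eq_or_lt.resolve_right fun h => (hG h hc').ne hgx).symm
    simp [← hgx, hgy]
  rcases (N.hit_nonneg hs' x).eq_or_lt with hhx | hhx
  · have hhy : N.hit s y = 0 :=
      ((N.hit_nonneg hs' y).eq_or_lt.resolve_right fun h => (hH h hc').ne hhx).symm
    simp [← hhx, hhy]
  have hsc : 0 < s * N.c x y := mul_pos hs.1 ((N.c_nonneg x y).lt_of_ne' hc)
  have hgy := hG hgx hc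
  have hhy := hH hhx hc
  refine .inr ⟨by positivity, by positivity, ?_⟩
  rw [Real.log_mul hsc.ne' (by positivity), Real.log_mul hsc.ne' (by positivity),
    Real.log_mul hgx.ne' hhy.ne', Real.log_mul hgy.ne' hhx.ne', potential, potential]
  ring

/-- A lower bound for the number of crossings of an edge that is linear in the net flow and in
the product of flow and potential drop, both of which can be summed over the network. -/
theorem mul_abs_flow_le (hs : s ∈ Set.Ioo (0 : ℝ) 1) (hq : 1 < q) (o x y : ι) :
    (pace q + paceSlope q * Real.log q) * |N.flow s o x y| ≤
      N.crossings s o x y + N.crossings s o y x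
        + paceSlope q * (N.flow s o x y * (N.potential s o x - N.potential s o y)) := by
  rw [← sub_le_iff_le_add, flow]
  rcases N.crossings_eq_zero_or_pos hs o x y with ⟨hxy, hyx⟩ | ⟨hxy, hyx, hpot⟩
  · simp [hxy, hyx]
  · rw [hpot]
    exact pace_tangent_le hq hxy hyx

theorem flow_mul_log_add_le (hs : s ∈ Set.Ioo (0 : ℝ) 1) (hq : 0 < q) (o x y : ι) :
    N.flow s o x y * Real.log q + (1 - q⁻¹) * N.crossings s o x y
        + (1 - q) * N.crossings s o y x ≤
      N.flow s o x y * (N.potential s o x - N.potential s o y) := by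
  rw [flow]
  rcases N.crossings_eq_zero_or_pos hs o x y with ⟨hxy, hyx⟩ | ⟨hxy, hyx, hpot⟩
  · simp [hxy, hyx]
  · rw [hpot]
    exact sub_mul_log_add_le hq hxy hyx

theorem exitMass_mul_drop_le (hs : s ∈ Set.Ioo (0 : ℝ) 1) (ho : 0 < N.hit s o) (hκ : 0 < κ)
    (x : ι) :
    N.exitMass s o x * (N.potential s o o - N.potential s o x) ≤
      N.exitMass s o x * (Real.log κ - 1)
        + s ^ 2 * N.b x * N.green s o o / (N.hit s o * κ) := by
  have hs' := Set.Ioo_subset_Ico_self hs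
  have hpole := N.green_pole_pos hs' o
  have hb := N.b_nonneg x
  have hrhs : 0 ≤ s ^ 2 * N.b x * N.green s o o / (N.hit s o * κ) := by positivity
  rcases (N.green_nonneg hs' o x).eq_or_lt with hgx | hgx
  · simpa [exitMass, ← hgx] using hrhs
  rcases eq_or_ne (N.b x) 0 with hbx | hbx
  · simp [exitMass, hbx]
  have hhx := N.hit_pos hs hbx
  set ratio := N.green s o o * N.hit s x / (N.hit s o * N.green s o x * κ) with hratio
  have hlog : N.potential s o o - N.potential s o x ≤ Real.log κ - 1 + ratio := by
    have h := Real.log_le_sub_one_of_pos (show 0 < ratio by positivity)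
    rw [hratio, Real.log_div (by positivity) (by positivity),
      Real.log_mul hpole.ne' hhx.ne', Real.log_mul (by positivity) hκ.ne',
      Real.log_mul ho.ne' hgx.ne', ← hratio] at h
    simp only [potential]
    linarith
  have hterm : N.exitMass s o x * ratio ≤
      s ^ 2 * N.b x * N.green s o o / (N.hit s o * κ) := by
    calc N.exitMass s o x * ratio
        = N.hit s x * (s * N.b x * N.green s o o / (N.hit s o * κ)) := by
          rw [exitMass, hratio]
          field_simp
      _ ≤ s * (s * N.b x * N.green s o o / (N.hit s o * κ)) :=
          mul_le_mul_of_nonneg_right (N.hit_le hs' x)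
            (div_nonneg (mul_nonneg (mul_nonneg hs.1.le hb) hpole.le) (by positivity))
      _ = s ^ 2 * N.b x * N.green s o o / (N.hit s o * κ) := by ring
  linarith [mul_le_mul_of_nonneg_left hlog (N.exitMass_nonneg hs' o x)]

/-- Jensen's inequality for the logarithm, with respect to the exit distribution. -/
theorem sum_exitMass_mul_drop_le (hs : s ∈ Set.Ioo (0 : ℝ) 1) (ho : 0 < N.hit s o) (hκ : 0 < κ)
    (h : s ^ 2 * (∑ x, N.b x) * N.green s o o ≤ κ * N.hit s o ^ 2) :
    ∑ x, N.exitMass s o x * (N.potential s o o - N.potential s o x) ≤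
      N.hit s o * Real.log κ := by
  have hsum := Finset.sum_le_sum fun x (_ : x ∈ Finset.univ) => N.exitMass_mul_drop_le hs ho hκ x
  rw [Finset.sum_add_distrib, ← Finset.sum_mul, N.sum_exitMass (Set.Ioo_subset_Ico_self hs),
    ← Finset.sum_div, ← Finset.sum_mul, ← Finset.mul_sum] at hsum
  have hle : s ^ 2 * (∑ x, N.b x) * N.green s o o / (N.hit s o * κ) ≤ N.hit s o := by
    rw [div_le_iff₀ (by positivity)]
    linarith
  linarith

end ConditionedWalk

section LevelFunction

variable {d : ι → ℝ}

/-- A level function counts levels from `0` at `o` to `n` on the vertices adjacent to the target,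
and it changes by at most `1` along an edge. The distance from `o` truncated at `n` is one. -/
structure IsLevelFunction (o : ι) (n : ℕ) (d : ι → ℝ) : Prop where
  pole : d o = 0
  le_add_one : ∀ x y, N.c x y ≠ 0 → d x ≤ d y + 1
  target : ∀ x, N.b x ≠ 0 → d x = n

variable {N}

theorem IsLevelFunction.b_pole (hd : N.IsLevelFunction o n d) (hn : n ≠ 0) : N.b o = 0 := by
  by_contra hb
  exact hn (by exact_mod_cast (hd.target o hb).symm.trans hd.pole)

variable (N)

theorem flow_mul_sub_le_abs (hd : ∀ x y, N.c x y ≠ 0 → d x ≤ d y + 1) (s : ℝ) (o x y : ι) :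
    N.flow s o x y * (d y - d x) ≤ |N.flow s o x y| := by
  by_cases hc : N.c x y = 0
  · simp [flow, crossings, hc, N.c_symm y x]
  have hxy := hd x y hc
  have hyx := hd y x (N.c_symm x y ▸ hc)
  refine (le_abs_self _).trans ?_
  rw [abs_mul]
  exact mul_le_of_le_one_right (abs_nonneg _) (abs_le.2 ⟨by linarith, by linarith⟩)

theorem sum_flow_mul_level (hs : s ∈ Set.Ico (0 : ℝ) 1) (htarget : ∀ x, N.b x ≠ 0 → d x = n)
    (o : ι) : ∑ x, ∑ y, N.flow s o x y * (d y - d x) = 2 * (n - d o) * N.hit s o := by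
  have hflow := N.sum_flow_mul_sub hs o (-d)
  have hexit : ∀ x, N.exitMass s o x * (d x - d o) = N.exitMass s o x * (n - d o) := fun x => by
    by_cases hb : N.b x = 0
    · simp [exitMass, hb]
    · rw [htarget x hb]
  simp only [Pi.neg_apply, neg_sub_neg, hexit, ← Finset.sum_mul, N.sum_exitMass hs] at hflow
  rw [hflow]
  ring

theorem two_mul_hit_le_sum_abs_flow (hs : s ∈ Set.Ico (0 : ℝ) 1) (hd : N.IsLevelFunction o n d) :
    2 * n * N.hit s o ≤ ∑ x, ∑ y, |N.flow s o x y| := by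
  have h := N.sum_flow_mul_level hs hd.target o
  rw [hd.pole, sub_zero] at h
  rw [← h]
  exact Finset.sum_le_sum fun x _ => Finset.sum_le_sum fun y _ =>
    N.flow_mul_sub_le_abs hd.le_add_one s o x y

theorem two_mul_hit_le_sum_erase_abs_flow [DecidableEq ι] (hs : s ∈ Set.Ico (0 : ℝ) 1)
    (hd : N.IsLevelFunction o n d) (hn : n ≠ 0) :
    2 * (n - 1) * N.hit s o ≤
      ∑ x ∈ Finset.univ.erase o, ∑ y ∈ Finset.univ.erase o, |N.flow s o x y| := by
  -- Merging the levels `0` and `1` makes the edges at `o` irrelevant.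
  have hn1 : (1 : ℝ) ≤ n := by exact_mod_cast Nat.one_le_iff_ne_zero.2 hn
  have hmax : ∀ x y, N.c x y ≠ 0 → max (d x) 1 ≤ max (d y) 1 + 1 := fun x y hxy =>
    max_le ((hd.le_add_one x y hxy).trans (by gcongr; exact le_max_left _ _))
      (by linarith [le_max_right (d y) 1])
  have hpole : ∀ y, N.flow s o o y * (max (d y) 1 - max (d o) 1) = 0 := fun y => by
    by_cases hc : N.c o y = 0
    · simp [flow, crossings, hc, N.c_symm y o]
    have hdy := hd.le_add_one y o (N.c_symm o y ▸ hc)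
    rw [hd.pole, zero_add] at hdy
    rw [hd.pole, max_eq_right hdy, max_eq_right zero_le_one, sub_self, mul_zero]
  have hsum := N.sum_flow_mul_level (d := fun x => max (d x) 1) hs
    (fun x hx => by rw [hd.target x hx, max_eq_left hn1]) o
  rw [sum_sum_eq_sum_erase_add (fun x y => by rw [N.flow_antisymm s o x y]; ring) o] at hsum
  simp only [hpole, Finset.sum_const_zero, mul_zero, sub_zero, add_zero] at hsum
  rw [hd.pole, max_eq_right zero_le_one] at hsum
  rw [← hsum]
  exact Finset.sum_le_sum fun x _ => Finset.sum_le_sum fun y _ => N.flow_mul_sub_le_abs hmax s o x y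

end LevelFunction

section StepCount

variable {d : ι → ℝ}

theorem sum_sum_crossings_add_swap (s : ℝ) (o : ι) :
    ∑ x, ∑ y, (N.crossings s o x y + N.crossings s o y x) = 2 * ∑ x, ∑ y, N.crossings s o x y := by
  simp only [Finset.sum_add_distrib]
  rw [Finset.sum_comm (f := fun x y => N.crossings s o y x), two_mul]

theorem mul_pace_le_sum_crossings (hs : s ∈ Set.Ioo (0 : ℝ) 1) (ho : 0 < N.hit s o)
    (hd : N.IsLevelFunction o n d) (hq : 1 < q)
    (h : s ^ 2 * (∑ x, N.b x) * N.green s o o ≤ q ^ n * N.hit s o ^ 2) :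
    n * N.hit s o * pace q ≤ ∑ x, ∑ y, N.crossings s o x y := by
  have hs' := Set.Ioo_subset_Ico_self hs
  have hdrop := mul_le_mul_of_nonneg_left (N.sum_exitMass_mul_drop_le hs ho (by positivity) h)
    (paceSlope_pos hq).le
  have hlevel := mul_le_mul_of_nonneg_left (N.two_mul_hit_le_sum_abs_flow hs' hd)
    (pace_add_paceSlope_mul_log_nonneg hq)
  have hedge := Finset.sum_le_sum fun x (_ : x ∈ Finset.univ) =>
    Finset.sum_le_sum fun y (_ : y ∈ Finset.univ) => N.mul_abs_flow_le hs hq o x y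
  simp only [Finset.sum_add_distrib (g := fun _ => paceSlope q * _), ← Finset.mul_sum,
    sum_sum_crossings_add_swap, N.sum_flow_mul_sub hs'] at hedge
  rw [Real.log_pow] at hdrop
  linarith

theorem one_lt_visits (hs : s ∈ Set.Ioo (0 : ℝ) 1) (ho : 0 < N.hit s o) (hb : N.b o = 0) :
    1 < N.visits s o := by
  have hs' := Set.Ioo_subset_Ico_self hs
  have hsum : ∑ y, N.c o y * N.hit s y ≠ 0 := fun h0 => by
    have hW := N.W_mul_hit hs' o
    rw [h0, hb, mul_zero, add_zero] at hW
    exact (mul_pos (N.W_pos o) ho).ne' hW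
  obtain ⟨y, -, hy⟩ := Finset.exists_ne_zero_of_sum_ne_zero hsum
  have hc : N.c o y ≠ 0 := left_ne_zero_of_mul hy
  have hgreen : 0 < N.green s o y :=
    N.pos_of_adj hs (N.laplacian_green_nonneg hs' o) (N.green_pole_pos hs' o) hc
  have hle : N.c o y * N.green s o y ≤ ∑ z, N.c o z * N.green s o z :=
    Finset.single_le_sum (f := fun z => N.c o z * N.green s o z)
      (fun z _ => mul_nonneg (N.c_nonneg o z) (N.green_nonneg hs' o z)) (Finset.mem_univ y)
  rw [visits, N.W_mul_green_self hs']
  exact lt_add_of_pos_left 1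
    (mul_pos hs.1 ((mul_pos ((N.c_nonneg o y).lt_of_ne' hc) hgreen).trans_le hle))

theorem hit_mul_log_le_sum_flow_pole (hs : s ∈ Set.Ioo (0 : ℝ) 1) (hb : N.b o = 0)
    (hR : 1 < N.visits s o) :
    N.hit s o * Real.log (N.visits s o / (N.visits s o - 1)) ≤
      ∑ y, N.flow s o o y * (N.potential s o o - N.potential s o y) := by
  have hs' := Set.Ioo_subset_Ico_self hs
  have hR0 : 0 < N.visits s o := by linarith
  have hR1 : 0 < N.visits s o - 1 := by linarith
  have hsum := Finset.sum_le_sum fun y (_ : y ∈ Finset.univ) =>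
    N.flow_mul_log_add_le hs (div_pos hR0 hR1) o o y
  rw [Finset.sum_add_distrib, Finset.sum_add_distrib, ← Finset.mul_sum, ← Finset.mul_sum,
    ← Finset.sum_mul, N.sum_crossings_from_pole hs' hb, N.sum_crossings_to_pole hs',
    N.sum_flow_pole hs', exitMass, hb] at hsum
  refine le_of_eq_of_le ?_ hsum
  field_simp
  ring

theorem mul_visits_add_le_sum_crossings (hs : s ∈ Set.Ioo (0 : ℝ) 1) (ho : 0 < N.hit s o)
    (hd : N.IsLevelFunction o n d) (hn : n ≠ 0) (hq : 1 < q) (hκ : 0 < κ)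
    (h : s ^ 2 * (∑ x, N.b x) * N.green s o o ≤ κ * N.hit s o ^ 2) :
    N.hit s o * ((n - 1) * (pace q + paceSlope q * Real.log q)
        - paceSlope q * (Real.log κ - Real.log (N.visits s o / (N.visits s o - 1)))
        + N.visits s o) ≤ ∑ x, ∑ y, N.crossings s o x y := by
  classical
  have hs' := Set.Ioo_subset_Ico_self hs
  have hb := hd.b_pole hn
  have hdrop := mul_le_mul_of_nonneg_left (N.sum_exitMass_mul_drop_le hs ho hκ h)
    (paceSlope_pos hq).le
  have hlevel := mul_le_mul_of_nonneg_left (N.two_mul_hit_le_sum_erase_abs_flow hs' hd hn)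
    (pace_add_paceSlope_mul_log_nonneg hq)
  set τ : ι → ι → ℝ := fun x y => N.crossings s o x y + N.crossings s o y x
    + paceSlope q * (N.flow s o x y * (N.potential s o x - N.potential s o y)) with hτ
  have hsum : ∑ x, ∑ y, τ x y = 2 * ∑ x, ∑ y, N.crossings s o x y
      + paceSlope q * (2 * ∑ x, N.exitMass s o x * (N.potential s o o - N.potential s o x)) := by
    rw [← N.sum_flow_mul_sub hs', ← N.sum_sum_crossings_add_swap]
    simp only [hτ, Finset.sum_add_distrib, Finset.mul_sum]
  have haway : (pace q + paceSlope q * Real.log q) * (2 * (n - 1) * N.hit s o) ≤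
      ∑ x ∈ Finset.univ.erase o, ∑ y ∈ Finset.univ.erase o, τ x y := by
    refine hlevel.trans ?_
    simp only [Finset.mul_sum]
    exact Finset.sum_le_sum fun x _ => Finset.sum_le_sum fun y _ => N.mul_abs_flow_le hs hq o x y
  have hstar : N.hit s o * (2 * N.visits s o - 1)
      + paceSlope q * (N.hit s o * Real.log (N.visits s o / (N.visits s o - 1))) ≤
        ∑ y, τ o y := by
    have hpole := mul_le_mul_of_nonneg_left
      (N.hit_mul_log_le_sum_flow_pole hs hb (N.one_lt_visits hs ho hb)) (paceSlope_pos hq).le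
    simp only [hτ, Finset.sum_add_distrib, ← Finset.mul_sum, N.sum_crossings_from_pole hs' hb,
      N.sum_crossings_to_pole hs']
    linarith
  have hloop : τ o o ≤ 2 * (N.hit s o * (N.visits s o - 1)) := by
    have hle : N.crossings s o o o ≤ N.hit s o * (N.visits s o - 1) := by
      rw [← N.sum_crossings_to_pole hs']
      exact Finset.single_le_sum (fun y _ => N.crossings_nonneg hs' o y o) (Finset.mem_univ o)
    simp only [hτ, sub_self, mul_zero]
    linarith
  rw [sum_sum_eq_sum_erase_add (fun x y => by simp only [hτ, N.flow_antisymm s o x y]; ring) o]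
    at hsum
  linarith

end StepCount

section StageDiscount

variable {d : ι → ℝ}

/-- The geometric mean `m` of the discounts of `n` stages on the way to the target that follow a
first step discounted by `s`, so that `E_o s^T = s * m ^ n`. -/
def stageDiscount (o : ι) (n : ℕ) (s : ℝ) : ℝ := (N.hit s o / s) ^ ((n : ℝ)⁻¹)

theorem mul_stageDiscount_pow (hs : s ∈ Set.Ioo (0 : ℝ) 1) (hn : n ≠ 0) (o : ι) :
    s * N.stageDiscount o n s ^ n = N.hit s o := by
  rw [stageDiscount, Real.rpow_inv_natCast_pow
    (div_nonneg (N.hit_nonneg (Set.Ioo_subset_Ico_self hs) o) hs.1.le) hn,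
    mul_div_cancel₀ _ hs.1.ne']

theorem stageDiscount_mem_Ioo (hs : s ∈ Set.Ioo (0 : ℝ) 1) (ho : 0 < N.hit s o) (hn : n ≠ 0)
    (hb : N.b o = 0) : N.stageDiscount o n s ∈ Set.Ioo (0 : ℝ) 1 := by
  refine ⟨Real.rpow_pos_of_pos (div_pos ho hs.1) _, ?_⟩
  refine Real.rpow_lt_one (div_pos ho hs.1).le ?_ (by positivity)
  rw [div_lt_one hs.1]
  nlinarith [N.hit_le_sq (Set.Ioo_subset_Ico_self hs) hb, hs.1, hs.2]

theorem hasDerivAt_stageDiscount (hs : s ∈ Set.Ioo (0 : ℝ) 1) (ho : 0 < N.hit s o) (n : ℕ) :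
    HasDerivAt (N.stageDiscount o n) (N.stageDiscount o n s *
      ((∑ x, ∑ y, N.crossings s o x y) / (n * N.hit s o)) / s) s := by
  have hs0 := hs.1.ne'
  have hquot := ((N.hasDerivAt_hit hs o).div (hasDerivAt_id s) hs0).rpow_const (p := (n : ℝ)⁻¹)
    (.inl (div_pos ho hs.1).ne')
  convert hquot using 1
  · rfl
  simp only [id_eq, Pi.div_apply]
  rw [N.sum_sum_crossings (Set.Ioo_subset_Ico_self hs), Real.rpow_sub_one (div_pos ho hs.1).ne',
    stageDiscount]
  field_simp

/-- The lower bound for the number of steps of the walk conditioned to hit the target that makes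
the comparison with bias `g` work: a stage takes at least as long as it does for the walk on `ℤ`
with bias `g`, discounted and conditioned to hit its target, whose odds are `g / m ^ 2`. -/
def StepBound (o : ι) (n : ℕ) (g : ℝ) : Prop :=
  ∀ ⦃s : ℝ⦄, s ∈ Set.Ioo (0 : ℝ) 1 → 0 < N.hit s o → N.stageDiscount o n s ≤ g ∧
    n * N.hit s o * pace (g / N.stageDiscount o n s ^ 2) ≤ ∑ x, ∑ y, N.crossings s o x y

theorem div_stageDiscount_sq_pow_mul_hit_sq (hs : s ∈ Set.Ioo (0 : ℝ) 1) (ho : 0 < N.hit s o)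
    (hn : n ≠ 0) (g : ℝ) :
    (g / N.stageDiscount o n s ^ 2) ^ n * N.hit s o ^ 2 = s ^ 2 * g ^ n := by
  have hm : 0 < N.stageDiscount o n s := Real.rpow_pos_of_pos (div_pos ho hs.1) _
  rw [← N.mul_stageDiscount_pow hs hn, div_pow, mul_pow, ← pow_mul, ← pow_mul, mul_comm n 2]
  field_simp

theorem stepBound_of_sum_b_mul_green_le (hn : n ≠ 0) (hd : N.IsLevelFunction o n d) (hg : 0 ≤ g)
    (h : ∀ s ∈ Set.Ioo (0 : ℝ) 1, (∑ x, N.b x) * N.green s o o ≤ g ^ n) : N.StepBound o n g := by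
  intro s hs ho
  have hs' := Set.Ioo_subset_Ico_self hs
  obtain ⟨hm0, hm1⟩ := N.stageDiscount_mem_Ioo hs ho hn (hd.b_pole hn)
  have hmg : N.stageDiscount o n s ≤ g := by
    refine le_of_pow_le_pow_left₀ hn hg (le_trans ?_ (h s hs))
    refine le_of_mul_le_mul_left ?_ hs.1
    rw [N.mul_stageDiscount_pow hs hn, ← N.sum_exitMass hs', Finset.sum_mul, Finset.mul_sum]
    refine Finset.sum_le_sum fun x _ => ?_
    rw [exitMass, mul_assoc, mul_comm (N.green s o x)]
    exact mul_le_mul_of_nonneg_left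
      (mul_le_mul_of_nonneg_left (N.green_le_pole hs' o x) (N.b_nonneg x)) hs.1.le
  have hq : 1 < g / N.stageDiscount o n s ^ 2 := by
    rw [one_lt_div (by positivity)]
    nlinarith
  refine ⟨hmg, N.mul_pace_le_sum_crossings hs ho hd hq ?_⟩
  rw [N.div_stageDiscount_sq_pow_mul_hit_sq hs ho hn, mul_assoc]
  exact mul_le_mul_of_nonneg_left (h s hs) (sq_nonneg s)

theorem stepBound_of_sum_b_le (hn : n ≠ 0) (hd : N.IsLevelFunction o n d) (hg : 1 < g)
    (h : (∑ x, N.b x) * (2 * g ^ 2) ≤ N.W o * ((g - 1) ^ 2 * g ^ n)) : N.StepBound o n g := by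
  intro s hs ho
  have hb := hd.b_pole hn
  have hg1 : 0 < g - 1 := sub_pos.2 hg
  obtain ⟨hm0, hm1⟩ := N.stageDiscount_mem_Ioo hs ho hn hb
  have hgq : g ≤ g / N.stageDiscount o n s ^ 2 := by
    rw [le_div_iff₀ (by positivity)]
    exact mul_le_of_le_one_right (by linarith) (pow_le_one₀ hm0.le hm1.le)
  have hR := N.one_lt_visits hs ho hb
  refine ⟨by linarith, ?_⟩
  rw [mul_comm (n : ℝ), mul_assoc]
  refine (mul_le_mul_of_nonneg_left (nat_mul_pace_le n hg hgq hR) ho.le).trans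
    (N.mul_visits_add_le_sum_crossings hs ho hd hn (hg.trans_le hgq) (by positivity) ?_)
  have hκ : N.visits s o * (g / N.stageDiscount o n s ^ 2) ^ n * ((g - 1) ^ 2 / (2 * g ^ 2))
      * N.hit s o ^ 2 = s ^ 2 * (N.W o * ((g - 1) ^ 2 * g ^ n) / (2 * g ^ 2)) * N.green s o o := by
    rw [mul_right_comm, mul_assoc (N.visits s o), N.div_stageDiscount_sq_pow_mul_hit_sq hs ho hn,
      visits]
    field_simp
  rw [hκ]
  refine mul_le_mul_of_nonneg_right (mul_le_mul_of_nonneg_left ?_ (sq_nonneg s))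
    (N.green_pole_pos (Set.Ioo_subset_Ico_self hs) o).le
  rwa [le_div_iff₀ (by positivity)]

variable {N}

theorem StepBound.add_one_mul_stageDiscount_le (hstep : N.StepBound o n g) (hn : n ≠ 0)
    (hb : N.b o = 0) (hs : s ∈ Set.Ioo (0 : ℝ) 1) (ho : 0 < N.hit s o) :
    (g + 1) * N.stageDiscount o n s ≤ s * (g + N.stageDiscount o n s ^ 2) := by
  have hmem : ∀ t ∈ Set.Ico s 1, t ∈ Set.Ioo (0 : ℝ) 1 := fun t ht => ⟨hs.1.trans_le ht.1, ht.2⟩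
  have hpos : ∀ t ∈ Set.Ico s 1, 0 < N.hit t o := fun t ht =>
    ho.trans_le (N.hit_mono hs (hmem t ht) ht.1 o)
  refine add_one_mul_le_of_hasDerivAt hs
    (fun t ht => N.stageDiscount_mem_Ioo (hmem t ht) (hpos t ht) hn hb)
    (fun t ht => (hstep (hmem t ht) (hpos t ht)).1)
    (fun t ht => N.hasDerivAt_stageDiscount (hmem t ht) (hpos t ht) n) (fun t ht => ?_)
  rw [le_div_iff₀ (mul_pos (by positivity) (hpos t ht)), mul_comm]
  exact (hstep (hmem t ht) (hpos t ht)).2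

end StageDiscount

end KilledNetwork

section DiscountedHitting

variable {V : Type*} {K K' : V → V → ℝ≥0∞} {A : Set V} {s : ℝ≥0∞} {x : V}

/-- `E_x[s ^ T; T ≤ k]`, where `T` is the hitting time of `A` by the chain with transition
probabilities `K`. -/
def hitWithin (K : V → V → ℝ≥0∞) (A : Set V) (s : ℝ≥0∞) : ℕ → V → ℝ≥0∞
  | 0, x => open Classical in if x ∈ A then 1 else 0
  | k + 1, x => open Classical in if x ∈ A then 1 else s * ∑' y, K x y * hitWithin K A s k y

/-- `E_x[s ^ T; T < ∞]`, where `T` is the hitting time of `A` by the chain with transition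
probabilities `K`. -/
def discountedHit (K : V → V → ℝ≥0∞) (A : Set V) (s : ℝ≥0∞) (x : V) : ℝ≥0∞ :=
  ⨆ k, hitWithin K A s k x

theorem hitWithin_of_mem (k : ℕ) (hx : x ∈ A) : hitWithin K A s k x = 1 := by
  cases k <;> simp [hitWithin, hx]

theorem hitWithin_succ (k : ℕ) (hx : x ∉ A) :
    hitWithin K A s (k + 1) x = s * ∑' y, K x y * hitWithin K A s k y := by
  rw [hitWithin, if_neg hx]

theorem hitWithin_mono (h : ∀ x y, K x y ≤ K' x y) (k : ℕ) (x : V) :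
    hitWithin K A s k x ≤ hitWithin K' A s k x := by
  induction k generalizing x with
  | zero => exact le_rfl
  | succ k ih =>
    by_cases hx : x ∈ A
    · rw [hitWithin_of_mem _ hx, hitWithin_of_mem _ hx]
    · rw [hitWithin_succ _ hx, hitWithin_succ _ hx]
      gcongr with y
      exacts [h x y, ih y]

theorem discountedHit_le_of_superharmonic {Φ : V → ℝ≥0∞} (hA : ∀ x ∈ A, 1 ≤ Φ x)
    (hΦ : ∀ x ∉ A, s * ∑' y, K x y * Φ y ≤ Φ x) (x : V) : discountedHit K A s x ≤ Φ x := by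
  refine iSup_le fun k => ?_
  induction k generalizing x with
  | zero =>
    rw [hitWithin]
    split_ifs with hx
    exacts [hA x hx, zero_le]
  | succ k ih =>
    by_cases hx : x ∈ A
    · exact (hitWithin_of_mem _ hx).trans_le (hA x hx)
    · rw [hitWithin_succ _ hx]
      refine le_trans ?_ (hΦ x hx)
      gcongr with y
      exact ih y

theorem le_hitWithin_add_pow_of_subharmonic {ψ : V → ℝ≥0∞} (hK : ∀ x, ∑' y, K x y ≤ 1)
    (hψ1 : ∀ x, ψ x ≤ 1) (hψ : ∀ x ∉ A, ψ x ≤ s * ∑' y, K x y * ψ y) (k : ℕ) (x : V) :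
    ψ x ≤ hitWithin K A s k x + s ^ k := by
  induction k generalizing x with
  | zero => exact (hψ1 x).trans (by simp)
  | succ k ih =>
    by_cases hx : x ∈ A
    · rw [hitWithin_of_mem _ hx]
      exact le_add_right (hψ1 x)
    rw [hitWithin_succ _ hx]
    calc ψ x ≤ s * ∑' y, K x y * (hitWithin K A s k y + s ^ k) := by
          refine (hψ x hx).trans ?_
          gcongr with y
          exact ih y
      _ = s * ∑' y, K x y * hitWithin K A s k y + s ^ (k + 1) * ∑' y, K x y := by
          simp only [mul_add, ENNReal.tsum_add, ENNReal.tsum_mul_right]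
          ring
      _ ≤ s * ∑' y, K x y * hitWithin K A s k y + s ^ (k + 1) := by
          gcongr
          exact mul_le_of_le_one_right' (hK x)

theorem le_discountedHit_of_subharmonic {ψ : V → ℝ≥0∞} (hK : ∀ x, ∑' y, K x y ≤ 1) (hs : s < 1)
    (hψ1 : ∀ x, ψ x ≤ 1) (hψ : ∀ x ∉ A, ψ x ≤ s * ∑' y, K x y * ψ y) (x : V) :
    ψ x ≤ discountedHit K A s x := by
  have hlim : Tendsto (fun k : ℕ => discountedHit K A s x + s ^ k) atTop
      (𝓝 (discountedHit K A s x)) := by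
    simpa only [add_zero] using
      tendsto_const_nhds.add (ENNReal.tendsto_pow_atTop_nhds_zero_of_lt_one hs)
  refine ge_of_tendsto' hlim fun k =>
    (le_hitWithin_add_pow_of_subharmonic hK hψ1 hψ k x).trans ?_
  gcongr
  exact le_iSup (fun k => hitWithin K A s k x) k

theorem one_le_discountedHit_of_mem (hx : x ∈ A) : 1 ≤ discountedHit K A s x :=
  le_iSup_of_le 0 (hitWithin_of_mem 0 hx).ge

theorem discountedHit_le_of_notMem (hK : ∀ x, ∑' y, K x y ≤ 1) (hs : s ≤ 1) (hx : x ∉ A) :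
    discountedHit K A s x ≤ s := by
  classical
  have h := discountedHit_le_of_superharmonic (K := K) (A := A) (s := s)
    (Φ := fun y => if y ∈ A then 1 else s) (fun y hy => by simp [hy]) (fun y hy => ?_) x
  · simpa [hx] using h
  · rw [if_neg hy]
    refine mul_le_of_le_one_right' ((ENNReal.tsum_le_tsum fun w => ?_).trans (hK y))
    refine mul_le_of_le_one_right' ?_
    split_ifs
    exacts [le_rfl, hs]

/-- The transition probabilities `K` of a chain that is killed when it leaves `B`. -/
def restrictTransition (K : V → V → ℝ≥0∞) (B : Finset V) (x y : V) : ℝ≥0∞ :=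
  open Classical in if y ∈ B then K x y else 0

theorem tsum_restrictTransition_mul (B : Finset V) (x : V) (f : V → ℝ≥0∞) :
    ∑' y, restrictTransition K B x y * f y = ∑ y ∈ B, K x y * f y := by
  rw [tsum_eq_sum fun y hy => by rw [restrictTransition, if_neg hy, zero_mul]]
  exact Finset.sum_congr rfl fun y hy => by rw [restrictTransition, if_pos hy]

theorem hitWithin_restrictTransition_mono (k : ℕ) (x : V) :
    Monotone fun B => hitWithin (restrictTransition K B) A s k x := fun B C hBC =>
  hitWithin_mono (fun x y => by
    unfold restrictTransition
    split_ifs with hB hC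
    exacts [le_rfl, absurd (hBC hB) hC, zero_le, le_rfl]) k x

theorem hitWithin_le_iSup_restrictTransition (k : ℕ) (x : V) :
    hitWithin K A s k x ≤ ⨆ B, hitWithin (restrictTransition K B) A s k x := by
  classical
  induction k generalizing x with
  | zero => exact le_iSup_of_le ∅ le_rfl
  | succ k ih =>
    by_cases hx : x ∈ A
    · exact le_iSup_of_le ∅ (by rw [hitWithin_of_mem _ hx, hitWithin_of_mem _ hx])
    rw [hitWithin_succ _ hx, ENNReal.tsum_eq_iSup_sum, ENNReal.mul_iSup]
    refine iSup_le fun F => ?_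
    calc s * ∑ y ∈ F, K x y * hitWithin K A s k y
        ≤ s * ∑ y ∈ F, ⨆ B, K x y * hitWithin (restrictTransition K B) A s k y := by
          gcongr with y
          rw [← ENNReal.mul_iSup]
          gcongr
          exact ih y
      _ = ⨆ B, s * ∑ y ∈ F, K x y * hitWithin (restrictTransition K B) A s k y := by
          rw [ENNReal.finsetSum_iSup_of_monotone fun y =>
            (hitWithin_restrictTransition_mono k y).const_mul' _, ENNReal.mul_iSup]
      _ ≤ _ := iSup_le fun B => le_iSup_of_le (F ∪ B) ?_
    rw [hitWithin_succ _ hx, tsum_restrictTransition_mul]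
    gcongr
    refine (Finset.sum_le_sum fun y _ => ?_).trans
      (Finset.sum_le_sum_of_subset Finset.subset_union_left)
    gcongr
    exact hitWithin_restrictTransition_mono k y Finset.subset_union_right

theorem discountedHit_le_iSup_restrictTransition (x : V) :
    discountedHit K A s x ≤ ⨆ B, discountedHit (restrictTransition K B) A s x :=
  iSup_le fun k => (hitWithin_le_iSup_restrictTransition k x).trans
    (iSup_mono fun _ => le_iSup (fun k => hitWithin _ A s k x) k)

end DiscountedHitting

section BiasedWalk

variable {g : ℝ}

theorem tsum_biasedTransition_mul (i : ℤ) (f : ℤ → ℝ≥0∞) :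
    ∑' j, biasedTransition g i j * f j =
      ENNReal.ofReal (g / (g + 1)) * f (i + 1) + ENNReal.ofReal (1 / (g + 1)) * f (i - 1) := by
  rw [tsum_eq_sum (s := {i + 1, i - 1}) fun j hj => ?_, Finset.sum_pair (by omega)]
  · rw [biasedTransition, if_pos rfl, biasedTransition, if_neg (by omega), if_pos rfl]
  · simp only [Finset.mem_insert, Finset.mem_singleton, not_or] at hj
    simp [biasedTransition, hj.1, hj.2]

theorem tsum_biasedTransition (hg : 0 ≤ g) (i : ℤ) : ∑' j, biasedTransition g i j = 1 := by
  have h := tsum_biasedTransition_mul (g := g) i fun _ => 1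
  simp only [mul_one] at h
  rw [h, ← ENNReal.ofReal_add (by positivity) (by positivity), ← add_div,
    div_self (by positivity), ENNReal.ofReal_one]

theorem pow_succ_le_biased_average (hg : 0 ≤ g) {s m : ℝ} (hm : 0 ≤ m)
    (h : (g + 1) * m ≤ s * (g + m ^ 2)) (j : ℕ) :
    m ^ (j + 1) ≤ s * (g / (g + 1) * m ^ j + 1 / (g + 1) * m ^ (j + 2)) :=
  calc m ^ (j + 1) = m ^ j * ((g + 1) * m) / (g + 1) := by field_simp; ring
    _ ≤ m ^ j * (s * (g + m ^ 2)) / (g + 1) := by gcongr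
    _ = _ := by field_simp; ring

theorem ofReal_pow_le_discountedHit_biasedTransition (hg : 0 ≤ g) {s m : ℝ}
    (hs : s ∈ Set.Ico (0 : ℝ) 1) (hm : m ∈ Set.Icc (0 : ℝ) 1)
    (h : (g + 1) * m ≤ s * (g + m ^ 2)) (n : ℕ) :
    ENNReal.ofReal (m ^ n) ≤
      discountedHit (biasedTransition g) {(n : ℤ)} (ENNReal.ofReal s) 0 := by
  have hm0 := hm.1
  set ψ : ℤ → ℝ≥0∞ := fun i => if i ≤ n then ENNReal.ofReal (m ^ (n - i).toNat) else 0
  have hψ1 (i : ℤ) : ψ i ≤ 1 := by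
    dsimp only [ψ]
    split_ifs
    exacts [ENNReal.ofReal_le_one.2 (pow_le_one₀ hm.1 hm.2), zero_le]
  have hψ (i : ℤ) (hi : i ∉ ({(n : ℤ)} : Set ℤ)) :
      ψ i ≤ ENNReal.ofReal s * ∑' j, biasedTransition g i j * ψ j := by
    rw [Set.mem_singleton_iff] at hi
    by_cases hin : i ≤ n
    · obtain ⟨j, hj⟩ : ∃ j : ℕ, i = n - (j + 1 : ℕ) := ⟨(n - i - 1).toNat, by omega⟩
      have hexp : (n - i).toNat = j + 1 ∧ (n - (i + 1)).toNat = j ∧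
          (n - (i - 1)).toNat = j + 2 := by omega
      rw [tsum_biasedTransition_mul]
      simp only [ψ, if_pos hin, if_pos (show i + 1 ≤ n by omega),
        if_pos (show i - 1 ≤ n by omega), hexp]
      rw [← ENNReal.ofReal_mul (by positivity), ← ENNReal.ofReal_mul (by positivity),
        ← ENNReal.ofReal_add (by positivity) (by positivity), ← ENNReal.ofReal_mul hs.1]
      exact ENNReal.ofReal_le_ofReal (pow_succ_le_biased_average hg hm0 h j)
    · simp only [ψ, if_neg hin]
      exact zero_le
  simpa [ψ] using le_discountedHit_of_subharmonic (fun i => (tsum_biasedTransition hg i).le)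
    (ENNReal.ofReal_lt_one.2 hs.2) hψ1 hψ 0

end BiasedWalk

section Paths

variable {V Ω : Type*} {X : ℕ → Ω → V} {A : Set V} {s : ℝ≥0∞} {ω : Ω}

/-- The discount `s ^ T`, where `T` is the time that the path needs from time `j` on to hit `A`,
and `0` if `T > k`. -/
def pathHit (X : ℕ → Ω → V) (A : Set V) (s : ℝ≥0∞) : ℕ → ℕ → Ω → ℝ≥0∞
  | 0, j, ω => open Classical in if X j ω ∈ A then 1 else 0
  | k + 1, j, ω => open Classical in if X j ω ∈ A then 1 else s * pathHit X A s k (j + 1) ω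

theorem pathHit_le_succ (k j : ℕ) : pathHit X A s k j ω ≤ pathHit X A s (k + 1) j ω := by
  induction k generalizing j with
  | zero =>
    simp only [pathHit]
    split_ifs <;> simp
  | succ k ih =>
    rw [pathHit, pathHit]
    split_ifs
    · rfl
    · gcongr
      exact ih _

theorem pathHit_eq_zero (k j : ℕ) (h : ∀ i ≤ k, X (j + i) ω ∉ A) : pathHit X A s k j ω = 0 := by
  induction k generalizing j with
  | zero => exact if_neg (h 0 le_rfl)
  | succ k ih =>
    have hj : X j ω ∉ A := h 0 (Nat.zero_le _)
    rw [pathHit, if_neg hj, ih (j + 1) fun i hi => ?_, mul_zero]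
    rw [add_assoc, add_comm 1 i]
    exact h (i + 1) (by omega)

theorem pathHit_eq_pow {t k : ℕ} (j : ℕ) (htk : t ≤ k) (ht : X (j + t) ω ∈ A)
    (h : ∀ i < t, X (j + i) ω ∉ A) : pathHit X A s k j ω = s ^ t := by
  induction t generalizing k j with
  | zero =>
    rw [add_zero] at ht
    cases k <;> simp [pathHit, ht]
  | succ t ih =>
    obtain ⟨k, rfl⟩ := Nat.exists_eq_add_of_le' (Nat.one_le_of_lt htk)
    have hj : X j ω ∉ A := h 0 t.succ_pos
    rw [pathHit, if_neg hj, ih (j + 1) (by omega) (by rwa [add_assoc, add_comm 1 t])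
      fun i hi => ?_, pow_succ']
    rw [add_assoc, add_comm 1 i]
    exact h (i + 1) (by omega)

theorem hittingTime_eq_top (h : ∀ k, X k ω ∉ A) : hittingTime X A ω = ⊤ := by
  simp [hittingTime, h]

theorem hittingTime_eq_coe {t : ℕ} (ht : X t ω ∈ A) (h : ∀ i < t, X i ω ∉ A) :
    hittingTime X A ω = t := by
  refine le_antisymm (iInf₂_le t ht) (le_iInf₂ fun k hk => ?_)
  by_contra! hlt
  exact h k (by exact_mod_cast hlt) hk

theorem expNeg_coe (l : ℝ) (t : ℕ) : expNeg l t = Real.exp (-l) ^ t := by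
  rw [expNeg, if_neg (ENat.natCast_ne_top t), ENat.toNat_natCast, ← Real.exp_nat_mul, mul_comm]

theorem expNeg_top (l : ℝ) : expNeg l ⊤ = 0 :=
  if_pos rfl

theorem iSup_pathHit (l : ℝ) :
    ⨆ k, pathHit X A (ENNReal.ofReal (Real.exp (-l))) k 0 ω =
      ENNReal.ofReal (expNeg l (hittingTime X A ω)) := by
  classical
  by_cases hex : ∃ k, X k ω ∈ A
  · have ht := Nat.find_spec hex
    have hlt : ∀ i < Nat.find hex, X i ω ∉ A := fun i => Nat.find_min hex
    rw [hittingTime_eq_coe ht hlt, expNeg_coe, ENNReal.ofReal_pow (Real.exp_pos _).le]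
    have hpow (k : ℕ) (hk : Nat.find hex ≤ k) :=
      pathHit_eq_pow (s := ENNReal.ofReal (Real.exp (-l))) 0 hk (by rwa [zero_add])
        (by simpa only [zero_add] using hlt)
    refine le_antisymm (iSup_le fun k => ?_) (le_iSup_of_le _ (hpow _ le_rfl).ge)
    by_cases hk : Nat.find hex ≤ k
    · exact (hpow k hk).le
    · refine (pathHit_eq_zero k 0 fun i hi => ?_).trans_le zero_le
      exact hlt _ (by omega)
  · push Not at hex
    rw [hittingTime_eq_top hex, expNeg_top, ENNReal.ofReal_zero, ENNReal.iSup_eq_zero]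
    exact fun k => pathHit_eq_zero k 0 fun i _ => hex _

theorem expNeg_nonneg (l : ℝ) (t : ℕ∞) : 0 ≤ expNeg l t := by
  induction t using ENat.recTopCoe with
  | top => exact (expNeg_top l).ge
  | coe t => exact (expNeg_coe l t).symm ▸ by positivity

theorem expNeg_le_one {l : ℝ} (hl : 0 ≤ l) (t : ℕ∞) : expNeg l t ≤ 1 := by
  induction t using ENat.recTopCoe with
  | top => exact (expNeg_top l).trans_le zero_le_one
  | coe t =>
    rw [expNeg_coe]
    exact pow_le_one₀ (Real.exp_pos _).le (Real.exp_le_one_iff.2 (neg_nonpos.2 hl))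

theorem expNeg_add_one (l : ℝ) (t : ℕ∞) : expNeg l (t + 1) = Real.exp (-l) * expNeg l t := by
  induction t using ENat.recTopCoe with
  | top => rw [top_add, expNeg_top, mul_zero]
  | coe t => rw [← Nat.cast_succ, expNeg_coe, expNeg_coe, pow_succ']

theorem continuous_expNeg (t : ℕ∞) : Continuous fun l => expNeg l t := by
  induction t using ENat.recTopCoe with
  | top => simp only [expNeg_top, continuous_const]
  | coe t => simp only [expNeg_coe]; fun_prop

/-- The event that the process follows the path `x` up to time `j`. -/
def pathEvent (X : ℕ → Ω → V) (j : ℕ) (x : ℕ → V) : Set Ω :=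
  {ω | ∀ i ≤ j, X i ω = x i}

theorem pathEvent_update_subset (j : ℕ) (x : ℕ → V) (y : V) :
    pathEvent X (j + 1) (Function.update x (j + 1) y) ⊆ pathEvent X j x := fun ω hω i hi => by
  rw [hω i (by omega), Function.update_of_ne (by omega)]

theorem pairwise_disjoint_pathEvent_update (j : ℕ) (x : ℕ → V) :
    Pairwise (Function.onFun Disjoint
      fun y => pathEvent X (j + 1) (Function.update x (j + 1) y)) := by
  refine fun y y' hne => Set.disjoint_left.2 fun ω h h' => hne ?_
  simpa using (h (j + 1) le_rfl).symm.trans (h' (j + 1) le_rfl)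

end Paths

section MarkovChain

variable {V Ω : Type*} [MeasurableSpace Ω] {P : Measure Ω} {K : V → V → ℝ≥0∞} {o : V}
  {X : ℕ → Ω → V}

theorem laplace_add_one (T : Ω → ℕ∞) (l : ℝ) :
    laplace P (fun ω => T ω + 1) l = Real.exp (-l) * laplace P T l := by
  simp only [laplace, expNeg_add_one, integral_const_mul]

/-- The paths that have positive probability visit only points at which `K` is stochastic. -/
def IsStochasticAlong (P : Measure Ω) (K : V → V → ℝ≥0∞) (X : ℕ → Ω → V) : Prop :=
  ∀ (j : ℕ) (x : ℕ → V), P (pathEvent X j x) ≠ 0 → ∑' y, K (x j) y = 1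

namespace IsMarkovChain

theorem measurableSet_pathEvent (hX : IsMarkovChain P K o X) (j : ℕ) (x : ℕ → V) :
    MeasurableSet (pathEvent X j x) := by
  have h : pathEvent X j x = ⋂ i ≤ j, X i ⁻¹' {x i} := by ext; simp [pathEvent]
  rw [h]
  exact MeasurableSet.biInter (Set.to_countable _) fun i _ =>
    hX.measurable i MeasurableSpace.measurableSet_top

theorem measure_pathEvent_update (hX : IsMarkovChain P K o X) (j : ℕ) (x : ℕ → V) (y : V) :
    P (pathEvent X (j + 1) (Function.update x (j + 1) y)) = P (pathEvent X j x) * K (x j) y := by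
  have h := hX.step j (Function.update x (j + 1) y)
  rw [Function.update_self, Function.update_of_ne (by omega)] at h
  refine h.trans (congrArg (P · * K (x j) y) (Set.ext fun ω => ?_))
  refine forall₂_congr fun i hi => ?_
  rw [Function.update_of_ne (by omega)]

theorem setLIntegral_pathEvent_eq_tsum [IsFiniteMeasure P] (hX : IsMarkovChain P K o X)
    (hK : IsStochasticAlong P K X) (j : ℕ) (x : ℕ → V) (f : Ω → ℝ≥0∞) :
    ∫⁻ ω in pathEvent X j x, f ω ∂P =
      ∑' y, ∫⁻ ω in pathEvent X (j + 1) (Function.update x (j + 1) y), f ω ∂P := by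
  by_cases hP : P (pathEvent X j x) = 0
  · rw [setLIntegral_measure_zero _ _ hP, eq_comm, ENNReal.tsum_eq_zero]
    exact fun y =>
      setLIntegral_measure_zero _ _ (measure_mono_null (pathEvent_update_subset j x y) hP)
  have hmeas (y : V) := hX.measurableSet_pathEvent (j + 1) (Function.update x (j + 1) y)
  set S := Function.support (K (x j))
  have : Countable S :=
    (Summable.countable_support_ennreal (by rw [hK j x hP]; exact ENNReal.one_ne_top)).to_subtype
  have hdisj := (pairwise_disjoint_pathEvent_update (X := X) j x).comp_of_injective
    (Subtype.val_injective (p := (· ∈ S)))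
  have hae : (⋃ y : S, pathEvent X (j + 1) (Function.update x (j + 1) y) : Set Ω)
      =ᵐ[P] pathEvent X j x := by
    refine ae_eq_of_subset_of_measure_ge
      (Set.iUnion_subset fun y => pathEvent_update_subset j x y) (Eq.ge ?_)
      (MeasurableSet.iUnion fun y : S => hmeas y).nullMeasurableSet (measure_ne_top _ _)
    rw [measure_iUnion hdisj fun y => hmeas y]
    simp only [hX.measure_pathEvent_update]
    rw [ENNReal.tsum_mul_left, tsum_subtype_support, hK j x hP, mul_one]
  rw [← setLIntegral_congr hae, lintegral_iUnion (fun y : S => hmeas y) hdisj,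
    tsum_subtype_eq_of_support_subset (f := fun y => ∫⁻ ω in pathEvent X (j + 1) _, f ω ∂P)]
  refine fun y hy => right_ne_zero_of_mul (a := P (pathEvent X j x)) fun h0 => hy ?_
  exact setLIntegral_measure_zero _ _ ((hX.measure_pathEvent_update j x y).trans h0)

theorem measurableSet_mem (hX : IsMarkovChain P K o X) (A : Set V) (j : ℕ) :
    MeasurableSet {ω | X j ω ∈ A} :=
  hX.measurable j (MeasurableSpace.measurableSet_top (s := A))

theorem measurable_pathHit (hX : IsMarkovChain P K o X) (A : Set V) (s : ℝ≥0∞) (k j : ℕ) :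
    Measurable (pathHit X A s k j) := by
  classical
  induction k generalizing j with
  | zero => exact Measurable.ite (hX.measurableSet_mem A j) measurable_const measurable_const
  | succ k ih =>
    exact Measurable.ite (hX.measurableSet_mem A j) measurable_const ((ih (j + 1)).const_mul s)

theorem setLIntegral_pathEvent_of_const (hX : IsMarkovChain P K o X) (j : ℕ) (x : ℕ → V)
    {f : Ω → ℝ≥0∞} {c : ℝ≥0∞} (hf : ∀ ω, X j ω = x j → f ω = c) :
    ∫⁻ ω in pathEvent X j x, f ω ∂P = P (pathEvent X j x) * c := by
  rw [setLIntegral_congr_fun (hX.measurableSet_pathEvent j x) fun ω hω => hf ω (hω j le_rfl),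
    setLIntegral_const, mul_comm]

theorem setLIntegral_pathHit [IsFiniteMeasure P] (hX : IsMarkovChain P K o X)
    (hK : IsStochasticAlong P K X) (A : Set V) (s : ℝ≥0∞) (k j : ℕ) (x : ℕ → V) :
    ∫⁻ ω in pathEvent X j x, pathHit X A s k j ω ∂P =
      P (pathEvent X j x) * hitWithin K A s k (x j) := by
  classical
  induction k generalizing j x with
  | zero =>
    exact hX.setLIntegral_pathEvent_of_const j x fun ω hω => by simp [pathHit, hitWithin, hω]
  | succ k ih =>
    by_cases hxA : x j ∈ A
    · exact hX.setLIntegral_pathEvent_of_const j x fun ω hω => by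
        simp [pathHit, hitWithin, hω, hxA]
    have hstep : Set.EqOn (pathHit X A s (k + 1) j) (fun ω => s * pathHit X A s k (j + 1) ω)
        (pathEvent X j x) := fun ω hω => if_neg ((hω j le_rfl).symm ▸ hxA)
    rw [setLIntegral_congr_fun (hX.measurableSet_pathEvent j x) hstep,
      lintegral_const_mul _ (hX.measurable_pathHit A s k _),
      hX.setLIntegral_pathEvent_eq_tsum hK, hitWithin_succ k hxA]
    calc _ = s * ∑' y, P (pathEvent X j x) * (K (x j) y * hitWithin K A s k y) := by
          congr! 3 with y
          rw [ih, Function.update_self, hX.measure_pathEvent_update, mul_assoc]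
      _ = _ := by rw [ENNReal.tsum_mul_left]; ring

theorem lintegral_pathHit [IsProbabilityMeasure P] (hX : IsMarkovChain P K o X)
    (hK : IsStochasticAlong P K X) (A : Set V) (s : ℝ≥0∞) (k : ℕ) :
    ∫⁻ ω, pathHit X A s k 0 ω ∂P = hitWithin K A s k o := by
  have hstart : pathEvent X 0 (fun _ => o) =ᵐ[P] Set.univ := by
    rw [eventuallyEq_univ]
    filter_upwards [hX.start] with ω hω i hi
    rwa [Nat.le_zero.1 hi]
  have h := hX.setLIntegral_pathHit hK A s k 0 fun _ => o
  rwa [setLIntegral_congr hstart, Measure.restrict_univ, measure_congr hstart, measure_univ,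
    one_mul] at h

theorem measurable_expNeg (hX : IsMarkovChain P K o X) (A : Set V) (l : ℝ) :
    Measurable fun ω => expNeg l (hittingTime X A ω) := by
  have h := (Measurable.iSup fun k =>
    hX.measurable_pathHit A (ENNReal.ofReal (Real.exp (-l))) k 0).ennreal_toReal
  simpa only [iSup_pathHit, ENNReal.toReal_ofReal (expNeg_nonneg _ _)] using h

theorem ofReal_laplace [IsProbabilityMeasure P] (hX : IsMarkovChain P K o X)
    (hK : IsStochasticAlong P K X) (A : Set V) {l : ℝ} (hl : 0 ≤ l) :
    ENNReal.ofReal (laplace P (hittingTime X A) l) =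
      discountedHit K A (ENNReal.ofReal (Real.exp (-l))) o := by
  have hint : Integrable (fun ω => expNeg l (hittingTime X A ω)) P :=
    .of_bound (hX.measurable_expNeg A l).aestronglyMeasurable 1 <| ae_of_all _ fun ω => by
      rw [Real.norm_of_nonneg (expNeg_nonneg _ _)]
      exact expNeg_le_one hl _
  rw [laplace, ofReal_integral_eq_lintegral_ofReal hint (ae_of_all _ fun ω => expNeg_nonneg _ _)]
  simp only [← iSup_pathHit]
  rw [lintegral_iSup (fun k => hX.measurable_pathHit A _ k 0)
    (monotone_nat_of_le_succ fun k ω => pathHit_le_succ k 0)]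
  simp only [hX.lintegral_pathHit hK, discountedHit]

theorem tendsto_laplace [IsFiniteMeasure P] (hX : IsMarkovChain P K o X) (A : Set V) :
    Tendsto (laplace P (hittingTime X A)) (𝓝[>] 0) (𝓝 (laplace P (hittingTime X A) 0)) := by
  refine tendsto_integral_filter_of_dominated_convergence (fun _ => 1)
    (Eventually.of_forall fun l => (hX.measurable_expNeg A l).aestronglyMeasurable) ?_
    (integrable_const 1)
    (ae_of_all _ fun ω => ((continuous_expNeg _).tendsto 0).mono_left nhdsWithin_le_nhds)
  filter_upwards [self_mem_nhdsWithin] with l hl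
  refine ae_of_all _ fun ω => ?_
  rw [Real.norm_of_nonneg (expNeg_nonneg _ _)]
  exact expNeg_le_one (le_of_lt hl) _

theorem laplace_hittingTime_le_laplace_add_one [IsProbabilityMeasure P]
    (hX : IsMarkovChain P K o X) (hK : IsStochasticAlong P K X) {V' Ω' : Type*}
    [MeasurableSpace Ω'] {P' : Measure Ω'} [IsProbabilityMeasure P'] {K' : V' → V' → ℝ≥0∞}
    {o' : V'} {Y : ℕ → Ω' → V'} (hY : IsMarkovChain P' K' o' Y) (hK' : IsStochasticAlong P' K' Y)
    {A : Set V} {A' : Set V'} (h : ∀ s ∈ Set.Ioo (0 : ℝ) 1, discountedHit K A (ENNReal.ofReal s) o ≤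
      ENNReal.ofReal s * discountedHit K' A' (ENNReal.ofReal s) o') {l : ℝ} (hl : 0 ≤ l) :
    laplace P (hittingTime X A) l ≤ laplace P' (fun ω => hittingTime Y A' ω + 1) l := by
  have hpos (l : ℝ) (hl : 0 < l) : laplace P (hittingTime X A) l ≤
      Real.exp (-l) * laplace P' (hittingTime Y A') l := by
    have hs := Real.exp_pos (-l)
    have hL : 0 ≤ laplace P' (hittingTime Y A') l := integral_nonneg fun ω => expNeg_nonneg _ _
    rw [← ENNReal.ofReal_le_ofReal_iff (mul_nonneg hs.le hL), ENNReal.ofReal_mul hs.le,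
      hX.ofReal_laplace hK A hl.le, hY.ofReal_laplace hK' A' hl.le]
    exact h _ ⟨hs, Real.exp_lt_one_iff.2 (neg_neg_of_pos hl)⟩
  rw [laplace_add_one]
  rcases hl.eq_or_lt with rfl | hl
  · have hexp : Tendsto (fun l : ℝ => Real.exp (-l)) (𝓝[>] 0) (𝓝 (Real.exp (-0))) :=
      (Real.continuous_exp.comp continuous_neg).continuousWithinAt
    refine le_of_tendsto_of_tendsto (hX.tendsto_laplace A) (hexp.mul (hY.tendsto_laplace A')) ?_
    filter_upwards [self_mem_nhdsWithin] with l hl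
    exact hpos l hl
  · exact hpos l hl

end IsMarkovChain

end MarkovChain

namespace WeightedGraph

section KilledWalk

variable {V : Type*} (G : WeightedGraph V) {o x y : V} {z : Set V} {B : Finset V} {n : ℕ}

theorem vertexWeight_ne_top (x : V) : G.vertexWeight x ≠ ⊤ :=
  G.sum_ne_top x

theorem weight_eq_zero (hy : G.vertexWeight y = 0) (x : V) : G.weight x y = 0 := by
  rw [G.symm]
  exact_mod_cast ENNReal.tsum_eq_zero.1 hy x

theorem sum_weight_le (B : Finset V) (x : V) :
    ∑ y ∈ B, (G.weight x y : ℝ) ≤ (G.vertexWeight x).toReal := by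
  rw [← ENNReal.ofReal_le_iff_le_toReal (G.vertexWeight_ne_top x),
    ENNReal.ofReal_sum_of_nonneg fun y _ => NNReal.coe_nonneg _]
  simp only [ENNReal.ofReal_coe_nnreal]
  exact ENNReal.sum_le_tsum B

theorem tsum_transition (x : V) :
    ∑' y, G.transition x y = G.vertexWeight x / G.vertexWeight x := by
  simp only [transition, div_eq_mul_inv, ENNReal.tsum_mul_right, vertexWeight]

theorem tsum_transition_le_one (x : V) : ∑' y, G.transition x y ≤ 1 :=
  (G.tsum_transition x).trans_le ENNReal.div_self_le_one

theorem isStochasticAlong_transition (ho : G.vertexWeight o ≠ 0) {Ω : Type*}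
    [MeasurableSpace Ω] {P : Measure Ω} {X : ℕ → Ω → V} (hX : IsMarkovChain P G.transition o X) :
    IsStochasticAlong P G.transition X := by
  intro j x hP
  rw [tsum_transition]
  refine ENNReal.div_self (fun h0 => ?_) (G.vertexWeight_ne_top _)
  cases j with
  | zero =>
    refine hP (measure_mono_null (fun ω (hω : ω ∈ pathEvent X 0 x) => ?_) hX.start)
    intro hstart
    exact ho (by rwa [← hstart, hω 0 le_rfl])
  | succ j =>
    refine hP ((hX.step j x).trans ?_)
    rw [transition, G.weight_eq_zero h0, ENNReal.coe_zero, ENNReal.zero_div, mul_zero]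

open scoped Classical in
/-- The vertices of `B` outside the target at which the walk can be. -/
def interior (z : Set V) (B : Finset V) : Finset V :=
  {x ∈ B | x ∉ z ∧ G.vertexWeight x ≠ 0}

variable {G} in
theorem mem_interior : x ∈ G.interior z B ↔ x ∈ B ∧ x ∉ z ∧ G.vertexWeight x ≠ 0 := by
  simp only [interior, Finset.mem_filter]

open scoped Classical in
theorem sum_mul_eq_sum_interior_add {M : Type*} [NonAssocSemiring M] {w : V → M}
    (hw : ∀ y, G.vertexWeight y = 0 → w y = 0) (z : Set V) (B : Finset V) (f : V → M) :
    ∑ y ∈ B, w y * f y =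
      ∑ y : G.interior z B, w y * f y + ∑ y ∈ B with y ∈ z, w y * f y := by
  rw [Finset.sum_coe_sort (G.interior z B) fun y => w y * f y,
    ← Finset.sum_filter_not_add_sum_filter B (· ∈ z)]
  congr 1
  refine (Finset.sum_subset (fun y hy => ?_) fun y hy hyI => ?_).symm
  · exact Finset.mem_filter.2 ⟨(mem_interior.1 hy).1, (mem_interior.1 hy).2.1⟩
  · rw [Finset.mem_filter] at hy
    have hy0 : G.vertexWeight y = 0 := by
      by_contra h
      exact hyI (mem_interior.2 ⟨hy.1, hy.2, h⟩)
    rw [hw y hy0, zero_mul]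

open scoped Classical in
/-- The network of the walk killed outside the finite set `B`, with target `z`. -/
def killed (z : Set V) (B : Finset V) : KilledNetwork (G.interior z B) where
  c x y := G.weight x y
  c_nonneg x y := (G.weight x y).2
  c_symm x y := by rw [G.symm]
  W x := (G.vertexWeight x).toReal
  W_pos x := ENNReal.toReal_pos (mem_interior.1 x.2).2.2 (G.vertexWeight_ne_top x)
  b x := ∑ y ∈ B with y ∈ z, (G.weight x y : ℝ)
  b_nonneg x := Finset.sum_nonneg fun y _ => (G.weight x y).2
  sum_le x := by
    have h := G.sum_mul_eq_sum_interior_add (w := fun y => (G.weight x y : ℝ))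
      (fun y hy => by rw [G.weight_eq_zero hy, NNReal.coe_zero]) z B 1
    simp only [Pi.one_apply, mul_one] at h
    exact h.symm.trans_le (G.sum_weight_le B x)

theorem ofReal_sum_b_le (z : Set V) (B : Finset V) :
    ENNReal.ofReal (∑ x, (G.killed z B).b x) ≤ G.setWeight z := by
  classical
  have hsum : ∑ x, (G.killed z B).b x ≤ ∑ y ∈ B with y ∈ z, (G.vertexWeight y).toReal := by
    refine Finset.sum_comm.trans_le (Finset.sum_le_sum fun y _ => ?_)
    rw [Finset.sum_coe_sort (G.interior z B) fun x => (G.weight x y : ℝ)]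
    simp only [G.symm _ y]
    exact G.sum_weight_le _ y
  refine (ENNReal.ofReal_le_ofReal hsum).trans ?_
  rw [ENNReal.ofReal_sum_of_nonneg fun y _ => ENNReal.toReal_nonneg, setWeight,
    tsum_subtype z G.vertexWeight]
  refine le_trans (Finset.sum_le_sum fun y hy => ?_) (ENNReal.sum_le_tsum {y ∈ B | y ∈ z})
  rw [ENNReal.ofReal_toReal (G.vertexWeight_ne_top y),
    Set.indicator_of_mem (Finset.mem_filter.1 hy).2]

theorem edist_le_add_one (o : V) (h : G.weight x y ≠ 0) :
    G.graph.edist o y ≤ G.graph.edist o x + 1 := by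
  rcases eq_or_ne x y with rfl | hxy
  · exact le_self_add
  · have hadj : G.graph.Adj x y := ⟨hxy, h⟩
    exact SimpleGraph.edist_triangle.trans_eq
      (congrArg _ (SimpleGraph.edist_eq_one_iff_adj.2 hadj))

/-- The graph distance from `o` truncated at `n`. -/
def truncDist (o : V) (n : ℕ) (x : V) : ℕ :=
  (min (G.graph.edist o x) n).toNat

theorem coe_truncDist (o : V) (n : ℕ) (x : V) :
    (G.truncDist o n x : ℕ∞) = min (G.graph.edist o x) n :=
  ENat.natCast_toNat (ne_top_of_le_ne_top (ENat.natCast_ne_top n) (min_le_right _ _))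

theorem isLevelFunction_truncDist (hdist : ∀ y ∈ z, (n + 1 : ℕ∞) ≤ G.graph.edist o y)
    (ho : o ∈ G.interior z B) :
    (G.killed z B).IsLevelFunction ⟨o, ho⟩ n fun x => G.truncDist o n x where
  pole := by simp [truncDist]
  le_add_one x y h := by
    have hw : G.weight y x ≠ 0 := by
      rw [G.symm]
      simpa [killed] using h
    have hle : (G.truncDist o n x : ℕ∞) ≤ (G.truncDist o n y + 1 : ℕ) := by
      rw [Nat.cast_succ, coe_truncDist, coe_truncDist, ← min_add_add_right]
      exact min_le_min (G.edist_le_add_one o hw) le_self_add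
    exact_mod_cast hle
  target x h := by
    classical
    obtain ⟨y, hy, hxy⟩ := Finset.exists_ne_zero_of_sum_ne_zero h
    have hle := (hdist y (Finset.mem_filter.1 hy).2).trans
      (G.edist_le_add_one o (NNReal.coe_ne_zero.1 hxy))
    have hn : (G.truncDist o n x : ℕ∞) = n := by
      rw [coe_truncDist, min_eq_right ((ENat.add_le_add_iff_right ENat.one_ne_top).1 hle)]
    exact_mod_cast hn

open scoped Classical in
/-- The discounted probability of reaching the target of `killed z B`, extended to all of `V` by `1`
on the target; the value `⊤` at the other vertices makes every condition there void. -/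
def hitMajorant (z : Set V) (B : Finset V) (s : ℝ) (y : V) : ℝ≥0∞ :=
  if y ∈ z then 1
  else if hy : y ∈ G.interior z B then ENNReal.ofReal ((G.killed z B).hit s ⟨y, hy⟩) else ⊤

theorem hitMajorant_of_mem (hx : x ∈ z) (B : Finset V) (s : ℝ) : G.hitMajorant z B s x = 1 :=
  if_pos hx

theorem hitMajorant_coe (s : ℝ) (x : G.interior z B) :
    G.hitMajorant z B s x = ENNReal.ofReal ((G.killed z B).hit s x) := by
  rw [hitMajorant, if_neg (mem_interior.1 x.2).2.1, dif_pos x.2]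

theorem sum_weight_mul_hitMajorant {s : ℝ} (hs : s ∈ Set.Ico (0 : ℝ) 1) (x : G.interior z B) :
    ∑ y ∈ B, (G.weight x y : ℝ≥0∞) * G.hitMajorant z B s y = ENNReal.ofReal
      (∑ y, (G.killed z B).c x y * (G.killed z B).hit s y + (G.killed z B).b x) := by
  classical
  set N := G.killed z B
  rw [G.sum_mul_eq_sum_interior_add (z := z) (fun y hy => by rw [G.weight_eq_zero hy]; rfl),
    ENNReal.ofReal_add (N.sum_c_mul_nonneg (N.hit_nonneg hs) x) (N.b_nonneg x),
    ENNReal.ofReal_sum_of_nonneg fun y _ => mul_nonneg (N.c_nonneg x y) (N.hit_nonneg hs y)]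
  congr 1
  · refine Finset.sum_congr rfl fun y _ => ?_
    rw [hitMajorant_coe, ENNReal.ofReal_mul (N.c_nonneg x y), ← ENNReal.ofReal_coe_nnreal]
    rfl
  · refine Eq.trans ?_ (ENNReal.ofReal_sum_of_nonneg fun y _ => (G.weight x y).2).symm
    refine Finset.sum_congr rfl fun y hy => ?_
    rw [G.hitMajorant_of_mem (Finset.mem_filter.1 hy).2, mul_one]
    exact ENNReal.ofReal_coe_nnreal.symm

theorem discountedHit_restrictTransition_le {s : ℝ} (hs : s ∈ Set.Ico (0 : ℝ) 1)
    (x : G.interior z B) :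
    discountedHit (restrictTransition G.transition B) z (ENNReal.ofReal s) x ≤
      ENNReal.ofReal ((G.killed z B).hit s x) := by
  set N := G.killed z B
  refine (discountedHit_le_of_superharmonic (Φ := G.hitMajorant z B s)
    (fun y hy => (G.hitMajorant_of_mem hy B s).ge) (fun y hy => ?_) (x : V)).trans_eq
    (G.hitMajorant_coe s x)
  by_cases hyI : y ∈ G.interior z B
  · have hW : ENNReal.ofReal (N.W ⟨y, hyI⟩) = G.vertexWeight y :=
      ENNReal.ofReal_toReal (G.vertexWeight_ne_top y)
    have hdiv : ∑ w ∈ B, G.transition y w * G.hitMajorant z B s w =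
        (∑ w ∈ B, (G.weight y w : ℝ≥0∞) * G.hitMajorant z B s w) / G.vertexWeight y := by
      simp only [transition, div_eq_mul_inv, Finset.sum_mul, mul_right_comm]
    rw [tsum_restrictTransition_mul, hdiv, G.sum_weight_mul_hitMajorant hs ⟨y, hyI⟩,
      ← mul_div_assoc, ← ENNReal.ofReal_mul hs.1, mul_add, ← N.W_mul_hit hs,
      G.hitMajorant_coe s ⟨y, hyI⟩, ← hW, ← ENNReal.ofReal_div_of_pos (N.W_pos _),
      mul_div_cancel_left₀ _ (N.W_pos _).ne']
  · rw [hitMajorant, if_neg hy, dif_neg hyI]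
    exact le_top

end KilledWalk

section Resistance

variable {V : Type*} (G : WeightedGraph V) {o : V} {z : Set V} {B : Finset V} {n : ℕ} {g s : ℝ}

theorem energy_add_tsum_weight_mul (f : V → ℝ≥0) :
    G.energy (fun x => f x) + ∑' x, ∑' y, (G.weight x y : ℝ≥0∞) * (f x * f y) =
      ∑' x, G.vertexWeight x * f x ^ 2 := by
  have hedge (a b : ℝ≥0) : ENNReal.ofReal (((a : ℝ) - b) ^ 2) + 2 * (a * b) =
      (a : ℝ≥0∞) ^ 2 + b ^ 2 := by
    have h : Real.toNNReal (((a : ℝ) - b) ^ 2) + 2 * (a * b) = a ^ 2 + b ^ 2 := by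
      ext
      push_cast [Real.coe_toNNReal _ (sq_nonneg ((a : ℝ) - b))]
      ring
    rw [ENNReal.ofReal]
    exact_mod_cast h
  have hswap : ∑' x, ∑' y, (G.weight x y : ℝ≥0∞) * (f y : ℝ≥0∞) ^ 2 =
      ∑' x, G.vertexWeight x * (f x : ℝ≥0∞) ^ 2 := by
    rw [ENNReal.tsum_comm]
    simp only [vertexWeight, ENNReal.tsum_mul_right, G.symm]
  have hdouble : ∑' x, ∑' y, (G.weight x y : ℝ≥0∞) * ENNReal.ofReal (((f x : ℝ) - f y) ^ 2) +
      2 * ∑' x, ∑' y, (G.weight x y : ℝ≥0∞) * (f x * f y) =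
      2 * ∑' x, G.vertexWeight x * (f x : ℝ≥0∞) ^ 2 := by
    rw [two_mul (∑' x, G.vertexWeight x * (f x : ℝ≥0∞) ^ 2)]
    nth_rewrite 2 [← hswap]
    simp only [vertexWeight, ← ENNReal.tsum_mul_right, ← ENNReal.tsum_mul_left,
      ← ENNReal.tsum_add]
    refine tsum_congr fun x => tsum_congr fun y => ?_
    rw [mul_left_comm, ← mul_add, ← mul_add, hedge]
  have hhalf (a : ℝ≥0∞) : 2 * a / 2 = a := by
    rw [mul_comm, ENNReal.mul_div_cancel_right two_ne_zero ENNReal.ofNat_ne_top]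
  rw [energy, ← hhalf (∑' x, ∑' y, _ * (_ * _)), ← ENNReal.add_div, hdouble, hhalf]

theorem energy_le_sum_mul_laplacian (hs : s ≤ 1) {f : V → ℝ≥0}
    (hf : ∀ x ∉ G.interior z B, f x = 0) :
    G.energy (fun x => f x) ≤ ENNReal.ofReal
      (∑ x : G.interior z B, f x * (G.killed z B).laplacian s (fun y => f y) x) := by
  set N := G.killed z B
  have hT : ∑' x, G.vertexWeight x * (f x : ℝ≥0∞) ^ 2 =
      ENNReal.ofReal (∑ x : G.interior z B, N.W x * (f x : ℝ) ^ 2) := by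
    rw [tsum_eq_sum (s := G.interior z B) fun x hx => by simp [hf x hx], ← Finset.sum_coe_sort,
      ENNReal.ofReal_sum_of_nonneg fun x _ => mul_nonneg (N.W_pos x).le (sq_nonneg _)]
    refine Finset.sum_congr rfl fun x _ => ?_
    rw [ENNReal.ofReal_mul (N.W_pos x).le, ENNReal.ofReal_pow (NNReal.coe_nonneg _),
      ENNReal.ofReal_coe_nnreal, ← ENNReal.ofReal_toReal (G.vertexWeight_ne_top x)]
    rfl
  have hC : ∑' x, ∑' y, (G.weight x y : ℝ≥0∞) * (f x * f y) =
      ENNReal.ofReal (∑ x : G.interior z B, ∑ y : G.interior z B, N.c x y * (f x * f y)) := by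
    have hff (x y : V) : 0 ≤ (f x : ℝ) * f y := mul_nonneg (f x).2 (f y).2
    rw [tsum_eq_sum (s := G.interior z B) fun x hx => by simp [hf x hx], ← Finset.sum_coe_sort,
      ENNReal.ofReal_sum_of_nonneg fun x _ =>
        Finset.sum_nonneg fun y _ => mul_nonneg (N.c_nonneg x y) (hff x y)]
    refine Finset.sum_congr rfl fun x _ => ?_
    rw [tsum_eq_sum (s := G.interior z B) fun y hy => by simp [hf y hy], ← Finset.sum_coe_sort,
      ENNReal.ofReal_sum_of_nonneg fun y _ => mul_nonneg (N.c_nonneg x y) (hff x y)]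
    refine Finset.sum_congr rfl fun y _ => ?_
    rw [ENNReal.ofReal_mul (N.c_nonneg x y), ENNReal.ofReal_mul (NNReal.coe_nonneg _)]
    simp only [ENNReal.ofReal_coe_nnreal, killed, N]
  have hC0 : 0 ≤ ∑ x : G.interior z B, ∑ y : G.interior z B, N.c x y * ((f x : ℝ) * f y) :=
    Finset.sum_nonneg fun x _ => Finset.sum_nonneg fun y _ => mul_nonneg (N.c_nonneg x y)
      (mul_nonneg (NNReal.coe_nonneg _) (NNReal.coe_nonneg _))
  have henergy := G.energy_add_tsum_weight_mul f
  rw [hT, hC] at henergy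
  rw [ENNReal.eq_sub_of_add_eq ENNReal.ofReal_ne_top henergy, ← ENNReal.ofReal_sub _ hC0]
  refine ENNReal.ofReal_le_ofReal ((sub_le_sub_left (mul_le_of_le_one_left hC0 hs) _).trans_eq ?_)
  simp only [N.laplacian_apply, mul_sub, Finset.sum_sub_distrib, Finset.mul_sum]
  congr 1
  · exact Finset.sum_congr rfl fun x _ => by ring
  · exact Finset.sum_congr rfl fun x _ => Finset.sum_congr rfl fun y _ => by ring

theorem ofReal_green_le_wiredResistance (hs : s ∈ Set.Ico (0 : ℝ) 1) (ho : o ∈ G.interior z B) :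
    ENNReal.ofReal ((G.killed z B).green s ⟨o, ho⟩ ⟨o, ho⟩) ≤ G.wiredResistance o z := by
  classical
  set N := G.killed z B
  set u := N.green s ⟨o, ho⟩
  have hpole : 0 < u ⟨o, ho⟩ := N.green_pole_pos hs _
  set f : V → ℝ≥0 := fun x =>
    if hx : x ∈ G.interior z B then Real.toNNReal (u ⟨x, hx⟩ / u ⟨o, ho⟩) else 0
  have hf (x : G.interior z B) : (f x : ℝ) = (u ⟨o, ho⟩)⁻¹ * u x := by
    simp only [f, dif_pos x.2, inv_mul_eq_div]
    exact Real.coe_toNNReal _ (div_nonneg (N.green_nonneg hs _ _) hpole.le)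
  have hf0 (x : V) (hx : x ∉ G.interior z B) : f x = 0 := dif_neg hx
  have henergy : ∑ x : G.interior z B, f x * N.laplacian s (fun y => f y) x =
      (u ⟨o, ho⟩)⁻¹ := by
    have hfu : (fun y : G.interior z B => (f y : ℝ)) = (u ⟨o, ho⟩)⁻¹ • u := funext hf
    rw [hfu, map_smul]
    simp only [hf, Pi.smul_apply, smul_eq_mul, mul_assoc, ← Finset.mul_sum]
    simp only [mul_left_comm (u _), ← Finset.mul_sum]
    rw [N.sum_green_mul_laplacian hs, inv_mul_cancel₀ hpole.ne', mul_one]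
  rw [wiredResistance, ENNReal.le_inv_iff_le_inv, ← ENNReal.ofReal_inv_of_pos hpole, ← henergy]
  refine (iInf₂_le (fun x => (f x : ℝ)) ⟨?_, fun y hy => ?_, 0, ?_⟩).trans
    (G.energy_le_sum_mul_laplacian hs.2.le hf0)
  · exact (hf ⟨o, ho⟩).trans (inv_mul_cancel₀ hpole.ne')
  · exact NNReal.coe_eq_zero.2 (hf0 y fun h => (mem_interior.1 h).2.1 hy)
  · refine (G.interior z B).finite_toSet.subset fun x hx => ?_
    by_contra h
    exact hx (NNReal.coe_eq_zero.2 (hf0 x h))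

theorem wiredResistance_le_freeResistance (o : V) (z : Set V) :
    G.wiredResistance o z ≤ G.freeResistance o z :=
  ENNReal.inv_le_inv.2 (biInf_mono fun _ hf => ⟨hf.1, hf.2.1⟩)

theorem stepBound_killed_of_setWeight_le (hn : n ≠ 0)
    (hdist : ∀ y ∈ z, (n + 1 : ℕ∞) ≤ G.graph.edist o y) (hg : 1 < g)
    (h : 2 * G.setWeight z / G.vertexWeight o ≤
      ENNReal.ofReal ((g - 1) ^ 2 * g ^ ((n : ℤ) - 2))) (ho : o ∈ G.interior z B) :
    (G.killed z B).StepBound ⟨o, ho⟩ n g := by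
  refine (G.killed z B).stepBound_of_sum_b_le hn (G.isLevelFunction_truncDist hdist ho) hg ?_
  have hg0 : 0 < g := one_pos.trans hg
  have hpow : g ^ ((n : ℤ) - 2) * g ^ 2 = g ^ n := by
    rw [zpow_sub₀ hg0.ne', zpow_natCast, zpow_ofNat, div_mul_cancel₀ _ (pow_pos hg0 2).ne']
  have hW : 2 * ∑ x, (G.killed z B).b x ≤
      (g - 1) ^ 2 * g ^ ((n : ℤ) - 2) * (G.vertexWeight o).toReal := by
    rw [← ENNReal.ofReal_le_ofReal_iff (by positivity), ENNReal.ofReal_mul zero_le_two,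
      ENNReal.ofReal_mul (by positivity), ENNReal.ofReal_toReal (G.vertexWeight_ne_top o),
      ENNReal.ofReal_ofNat]
    exact (mul_le_mul_right (G.ofReal_sum_b_le z B) 2).trans ((ENNReal.div_le_iff
      (mem_interior.1 ho).2.2 (G.vertexWeight_ne_top o)).1 h)
  calc (∑ x, (G.killed z B).b x) * (2 * g ^ 2) = 2 * (∑ x, (G.killed z B).b x) * g ^ 2 := by ring
    _ ≤ (g - 1) ^ 2 * g ^ ((n : ℤ) - 2) * (G.vertexWeight o).toReal * g ^ 2 := by gcongr
    _ = (G.vertexWeight o).toReal * ((g - 1) ^ 2 * g ^ n) := by rw [← hpow]; ring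

theorem stepBound_killed_of_wiredResistance_le (hn : n ≠ 0)
    (hdist : ∀ y ∈ z, (n + 1 : ℕ∞) ≤ G.graph.edist o y) {r : ℝ≥0∞}
    (hr : G.wiredResistance o z ≤ r) (hfin : G.setWeight z * r ≠ ⊤)
    (hg : (G.setWeight z * r).toReal ^ (1 / (n : ℝ)) ≤ g) (ho : o ∈ G.interior z B) :
    (G.killed z B).StepBound ⟨o, ho⟩ n g := by
  have hg0 : 0 ≤ g := (Real.rpow_nonneg ENNReal.toReal_nonneg _).trans hg
  refine (G.killed z B).stepBound_of_sum_b_mul_green_le hn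
    (G.isLevelFunction_truncDist hdist ho) hg0 fun s hs => ?_
  have hpow : (G.setWeight z * r).toReal ≤ g ^ n := by
    rwa [one_div, Real.rpow_inv_le_iff_of_pos ENNReal.toReal_nonneg hg0 (by positivity),
      Real.rpow_natCast] at hg
  refine le_trans ?_ hpow
  rw [← ENNReal.ofReal_le_iff_le_toReal hfin,
    ENNReal.ofReal_mul (Finset.sum_nonneg fun x _ => (G.killed z B).b_nonneg x)]
  exact mul_le_mul' (G.ofReal_sum_b_le z B)
    ((G.ofReal_green_le_wiredResistance (Set.Ioo_subset_Ico_self hs) ho).trans hr)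

theorem discountedHit_transition_le_biasedTransition (ho : G.vertexWeight o ≠ 0) (hoz : o ∉ z)
    (hn : n ≠ 0) (hdist : ∀ y ∈ z, (n + 1 : ℕ∞) ≤ G.graph.edist o y) (hg : 0 ≤ g)
    (hstep : ∀ B (hoB : o ∈ G.interior z B), (G.killed z B).StepBound ⟨o, hoB⟩ n g)
    (hs : s ∈ Set.Ioo (0 : ℝ) 1) :
    discountedHit G.transition z (ENNReal.ofReal s) o ≤ ENNReal.ofReal s *
      discountedHit (biasedTransition g) {(n : ℤ)} (ENNReal.ofReal s) 0 := by
  classical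
  refine (discountedHit_le_iSup_restrictTransition o).trans (iSup_le fun B => ?_)
  refine (iSup_mono fun k =>
    hitWithin_restrictTransition_mono k o (Finset.subset_insert o B)).trans ?_
  have hoI : o ∈ G.interior z (insert o B) :=
    mem_interior.2 ⟨Finset.mem_insert_self o B, hoz, ho⟩
  set N := G.killed z (insert o B)
  have hs' := Set.Ioo_subset_Ico_self hs
  refine (G.discountedHit_restrictTransition_le hs' ⟨o, hoI⟩).trans ?_
  rcases (N.hit_nonneg hs' ⟨o, hoI⟩).eq_or_lt with h0 | hpos
  · rw [← h0, ENNReal.ofReal_zero]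
    exact zero_le
  have hb : N.b ⟨o, hoI⟩ = 0 := (G.isLevelFunction_truncDist hdist hoI).b_pole hn
  have hm := N.stageDiscount_mem_Ioo hs hpos hn hb
  rw [← N.mul_stageDiscount_pow hs hn, ENNReal.ofReal_mul hs.1.le]
  gcongr
  exact ofReal_pow_le_discountedHit_biasedTransition hg hs' (Set.Ioo_subset_Icc_self hm)
    ((hstep _ hoI).add_one_mul_stageDiscount_le hn hb hs hpos) n

end Resistance

end WeightedGraph

end

theorem proposition2_general {V : Type*} (G : WeightedGraph V) (o : V) (z : Set V) (n : ℕ)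
    (ho : G.vertexWeight o ≠ 0) (hdist : ∀ y ∈ z, (n + 1 : ℕ∞) ≤ G.graph.edist o y) (g : ℝ)
    (hg : (1 < g ∧ 2 * G.setWeight z / G.vertexWeight o ≤
        ENNReal.ofReal ((g - 1) ^ 2 * g ^ ((n : ℤ) - 2))) ∨
      (∃ r : ℝ≥0∞, G.wiredResistance o z ≤ r ∧ G.setWeight z * r ≠ ⊤ ∧
        (G.setWeight z * r).toReal ^ (1 / (n : ℝ)) ≤ g))
    {Ω : Type*} [MeasurableSpace Ω] (P : Measure Ω) [IsProbabilityMeasure P]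
    (X : ℕ → Ω → V) (hX : IsMarkovChain P G.transition o X)
    {Ω' : Type*} [MeasurableSpace Ω'] (P' : Measure Ω') [IsProbabilityMeasure P']
    (Y : ℕ → Ω' → ℤ) (hY : IsMarkovChain P' (biasedTransition g) 0 Y) (l : ℝ) (hl : 0 ≤ l) :
    laplace P (hittingTime X z) l ≤
      laplace P' (fun ω => hittingTime Y {(n : ℤ)} ω + 1) l := by
  have hoz : o ∉ z := fun h => by simpa using hdist o h
  have hg0 : 0 ≤ g := hg.elim (fun h => zero_le_one.trans h.1.le) fun ⟨_, _, _, h⟩ =>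
    (Real.rpow_nonneg ENNReal.toReal_nonneg _).trans h
  refine hX.laplace_hittingTime_le_laplace_add_one (G.isStochasticAlong_transition ho hX) hY
    (fun j x _ => tsum_biasedTransition hg0 (x j)) (fun s hs => ?_) hl
  rcases eq_or_ne n 0 with rfl | hn
  · have htarget : (0 : ℤ) ∈ ({((0 : ℕ) : ℤ)} : Set ℤ) := rfl
    exact (discountedHit_le_of_notMem G.tsum_transition_le_one
      (ENNReal.ofReal_le_one.2 hs.2.le) hoz).trans
      (le_mul_of_one_le_right' (one_le_discountedHit_of_mem htarget))
  · refine G.discountedHit_transition_le_biasedTransition ho hoz hn hdist hg0 (fun B hoB => ?_) hs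
    rcases hg with ⟨hg1, hweight⟩ | ⟨r, hr, hfin, hgr⟩
    · exact G.stepBound_killed_of_setWeight_le hn hdist hg1 hweight hoB
    · exact G.stepBound_killed_of_wiredResistance_le hn hdist hr hfin hgr hoB

theorem proposition2 {V : Type*} (G : WeightedGraph V) (o : V) (z : Set V) (n : ℕ)
    (ho : G.vertexWeight o ≠ 0)
    (hdist : ∀ y ∈ z, (n + 1 : ℕ∞) ≤ G.graph.edist o y)
    (g : ℝ)
    (hg :
      -- (a)
      (1 < g ∧ ENNReal.ofReal ((g - 1) ^ 2 * g ^ ((n : ℤ) - 2))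
          = 2 * G.setWeight z / G.vertexWeight o) ∨
      -- (b)
      (∃ r : ℝ≥0∞, (r = G.freeResistance o z ∨ r = G.wiredResistance o z) ∧
        G.setWeight z * r ≠ ⊤ ∧ g = (G.setWeight z * r).toReal ^ (1 / (n : ℝ))))
    -- the random walk on the weighted graph, started at `o`
    {Ω : Type*} [MeasurableSpace Ω] (P : Measure Ω) [IsProbabilityMeasure P]
    (X : ℕ → Ω → V) (hX : IsMarkovChain P G.transition o X)
    -- biased simple random walk on the integers, started at `0`
    {Ω' : Type*} [MeasurableSpace Ω'] (P' : Measure Ω') [IsProbabilityMeasure P']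
    (Y : ℕ → Ω' → ℤ) (hY : IsMarkovChain P' (biasedTransition g) 0 Y)
    (l : ℝ) (hl : 0 ≤ l) :
    laplace P (hittingTime X z) l ≤
      laplace P' (fun ω => hittingTime Y {(n : ℤ)} ω + 1) l := by
  exact proposition2_general G o z n ho hdist g (hg.imp (And.imp_right ge_of_eq) fun ⟨r, hr, h⟩ =>
    ⟨r, hr.elim (· ▸ G.wiredResistance_le_freeResistance o z) ge_of_eq, h.imp_right ge_of_eq⟩)
    P X hX P' Y hY l hl
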